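/- Let $n\ge 1$ and $L^2(\mathbb R^n)$ be the complex Hilbert space with inner product $\langle f,g\rangle=\int f\bar g\,dx$. For $\alpha\in\mathbb N^n$ ($\mathbb N=\{0,1,\dots\}$) let $h_\alpha(x)=\prod_{i=1}^n h_{\alpha_i}(x_i)$, where $h_k(t)=(2^kk!\sqrt\pi)^{-1/2}H_k(t)e^{-t^2/2}$ and $H_k$ is the (physicists') Hermite polynomial, and put $|\alpha|=\alpha_1+\dots+\alpha_n$. For $\beta>-1$ and $k\in\mathbb N$ let $$\ell_k^\beta(r)=\Big(\frac{2\Gamma(k+1)}{\Gamma(k+\beta+1)}\Big)^{1/2}L_k^\beta(r^2)e^{-r^2/2},$$ where $L_k^\beta$ is the Laguerre polynomial of degree $k$ and order $\beta$. For $s\in\mathbb N$ let $H_{(s)}$ be the space of harmonic homogeneous polynomials of degree $s$ in $n$ variables with complex coefficients, let $d_s=\dim H_{(s)}$, let $Y_{s,1},\dots,Y_{s,d_s}$ be any basis of $H_{(s)}$ whose restrictions to the unit sphere are orthonormal with respect to the surface measure (the counting measure on $\{-1,1\}$ if $n=1$), and put $$\phi_{k,s,j}(x)=\ell_k^{\frac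 n2-1+s}(|x|)\,Y_{s,j}(x),\qquad k,s\in\mathbb N,\ 1\le j\le d_s .$$ Then $\{h_\alpha\}$ and $\{\phi_{k,s,j}\}$ are orthonormal bases of $L^2(\mathbb R^n)$. Let $\mathcal H$ and $\widetilde{\mathcal H}$ be the operators $$\mathcal Hf=\sum_{\alpha}(n+2|\alpha|)\langle f,h_\alpha\rangle h_\alpha,\qquad \widetilde{\mathcal H}f=\sum_{k,s,j}(n+2(s+2k))\langle f,\phi_{k,s,j}\rangle\phi_{k,s,j},$$ with domains $\{f:\sum_\alpha|(n+2|\alpha|)\langle f,h_\alpha\rangle|^2<\infty\}$ and $\{f:\sum_{k,s,j}|(n+2(s+2k))\langle f,\phi_{k,s,j}\rangle|^2<\infty\}$. Both are self-adjoint extensions of the harmonic oscillator $-\Delta+|x|^2$ with domain $C_c^\infty(\mathbb R^n)$, and $$\mathcal H=\widetilde{\mathcal H}.$$ Moreover, for every $m\in\mathbb N$: 1. $\Pi_{n+2m}=\widetilde\Pi_{n+2m}$, where $$\Pi_{n+2m}f=\sum_{|\alpha|=m}\langle f,h_\alpha\rangle h_\alpha,\qquad \widetilde\Pi_{n+2m}f=\sum_{0\le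 k\le\lfloor m/2\rfloor}\ \sum_{1\le j\le d_{m-2k}}\langle f,\phi_{k,m-2k,j}\rangle\phi_{k,m-2k,j},\qquad f\in L^2(\mathbb R^n).$$ 2. The integral kernels coincide: for all $x,y\in\mathbb R^n$, $$\sum_{|\alpha|=m}h_\alpha(x)h_\alpha(y)=\sum_{0\le k\le\lfloor m/2\rfloor}\ \sum_{1\le j\le d_{m-2k}}\phi_{k,m-2k,j}(x)\overline{\phi_{k,m-2k,j}(y)} .$$ 3. As spaces of functions on $\mathbb R^n$, $$\operatorname{lin}\{h_\alpha:|\alpha|=m\}=\operatorname{lin}\{\phi_{k,m-2k,j}:0\le k\le\lfloor m/2\rfloor,\ 1\le j\le d_{m-2k}\}.$$ -/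

import Mathlib

open MeasureTheory
open scoped ContDiff

noncomputable section

namespace PolarOscillator

/-- The Euclidean space `ℝⁿ`. -/
abbrev Rn (n : ℕ) : Type := EuclideanSpace ℝ (Fin n)

/-- The complex Hilbert space `L²(ℝⁿ)` with respect to Lebesgue measure. -/
abbrev L2 (n : ℕ) : Type := Lp ℂ 2 (volume : Measure (Rn n))

/-! ### Hermite functions -/

/-- The (physicists') Hermite polynomial `H_k(x) = 2^{k/2} He_k(√2 x)`, where `He_k` is Mathlib's
(probabilists') Hermite polynomial; thus `H_0 = 1`, `H_1(x) = 2x`, `H_2(x) = 4x² - 2`, … -/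
def hermitePoly (k : ℕ) (x : ℝ) : ℝ :=
  √2 ^ k * Polynomial.aeval (√2 * x) (Polynomial.hermite k)

/-- The one-dimensional Hermite function
`h_k(x) = (2^k k! √π)^{-1/2} H_k(x) e^{-x²/2}`. -/
def hermiteFun1 (k : ℕ) (x : ℝ) : ℝ :=
  (√(2 ^ k * (k.factorial : ℝ) * √Real.pi))⁻¹ * hermitePoly k x * Real.exp (-x ^ 2 / 2)

/-- The Hermite function `h_α(x) = ∏ᵢ h_{αᵢ}(xᵢ)` on `ℝⁿ`. -/
def hermiteFun {n : ℕ} (α : Fin n → ℕ) (x : Rn n) : ℂ :=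
  ((∏ i, hermiteFun1 (α i) (x i) : ℝ) : ℂ)

/-! ### Laguerre functions -/

/-- The Laguerre polynomial of order `β > -1` and degree `k`,
`L_k^β(t) = ∑_{i ≤ k} Γ(k+β+1) / Γ(i+β+1) · (-t)^i / (i! (k-i)!)`. -/
def laguerrePoly (β : ℝ) (k : ℕ) (t : ℝ) : ℝ :=
  ∑ i ∈ Finset.range (k + 1),
    Real.Gamma (k + β + 1) / Real.Gamma (i + β + 1) *
      ((-t) ^ i / ((i.factorial : ℝ) * ((k - i).factorial : ℝ)))

/-- The Laguerre function (of convolution type)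
`ℓ_k^β(r) = (2 Γ(k+1) / Γ(k+β+1))^{1/2} L_k^β(r²) e^{-r²/2}`. -/
def laguerreFun (β : ℝ) (k : ℕ) (r : ℝ) : ℝ :=
  √(2 * Real.Gamma (k + 1) / Real.Gamma (k + β + 1)) * laguerrePoly β k (r ^ 2) *
    Real.exp (-r ^ 2 / 2)

/-! ### Solid harmonics -/

/-- The Laplacian `∑ᵢ ∂ᵢ²` on polynomials in `n` variables. -/
def polyLaplacian (n : ℕ) : MvPolynomial (Fin n) ℂ →ₗ[ℂ] MvPolynomial (Fin n) ℂ :=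
  ∑ i, (MvPolynomial.pderiv (R := ℂ) i).toLinearMap ∘ₗ (MvPolynomial.pderiv (R := ℂ) i).toLinearMap

/-- The space `H_(s)` of solid harmonics homogeneous of degree `s`: the harmonic homogeneous
polynomials of degree `s` in `n` variables with complex coefficients. -/
def SolidHarmonic (n s : ℕ) : Submodule ℂ (MvPolynomial (Fin n) ℂ) :=
  MvPolynomial.homogeneousSubmodule (Fin n) ℂ s ⊓ LinearMap.ker (polyLaplacian n)

/-- `d_s = dim H_(s)`. -/
def harmonicDim (n s : ℕ) : ℕ := Module.finrank ℂ (SolidHarmonic n s)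

/-- The value of a polynomial at a point of `ℝⁿ`. -/
def evalAt {n : ℕ} (p : MvPolynomial (Fin n) ℂ) (x : Rn n) : ℂ :=
  MvPolynomial.eval (fun i => ((x i : ℝ) : ℂ)) p

/-- The inner product `∫ p q̄ dσ` in `L²` of the unit sphere of the restrictions of two polynomials,
where `σ` is the surface measure (the counting measure on `{-1, 1}` if `n = 1`). -/
def sphereInner {n : ℕ} (p q : MvPolynomial (Fin n) ℂ) : ℂ :=
  ∫ x : Metric.sphere (0 : Rn n) 1, evalAt p x * star (evalAt q x)
    ∂(volume : Measure (Rn n)).toSphere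

/-- A choice, for every `s`, of a basis `Y_{s,1}, …, Y_{s,d_s}` of `H_(s)`. -/
abbrev HarmonicBases (n : ℕ) : Type :=
  (s : ℕ) → Module.Basis (Fin (harmonicDim n s)) ℂ (SolidHarmonic n s)

/-- Each of the chosen bases of the spaces `H_(s)` is orthonormal in `L²` of the unit sphere. -/
def HarmonicBases.IsOrthonormal {n : ℕ} (Y : HarmonicBases n) : Prop :=
  ∀ (s : ℕ) (i j : Fin (harmonicDim n s)),
    sphereInner (Y s i : MvPolynomial (Fin n) ℂ) (Y s j : MvPolynomial (Fin n) ℂ) =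
      if i = j then 1 else 0

/-- `φ_{k,s,j}(x) = ℓ_k^{n/2-1+s}(|x|) Y_{s,j}(x)`. -/
def phiFun {n : ℕ} (Y : HarmonicBases n) (k s : ℕ) (j : Fin (harmonicDim n s)) (x : Rn n) : ℂ :=
  ((laguerreFun ((n : ℝ) / 2 - 1 + s) k ‖x‖ : ℝ) : ℂ) * evalAt (Y s j : MvPolynomial (Fin n) ℂ) x

/-! ### Square integrability -/

theorem evalAt_continuous {n : ℕ} (p : MvPolynomial (Fin n) ℂ) :
    Continuous fun x : Rn n => evalAt p x := by
  unfold evalAt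
  exact (MvPolynomial.continuous_eval p).comp (by fun_prop)

theorem evalAt_growth {n : ℕ} (p : MvPolynomial (Fin n) ℂ) :
    ∃ (C : ℝ) (N : ℕ), 0 ≤ C ∧ ∀ x : Rn n, ‖evalAt p x‖ ≤ C * (1 + ‖x‖) ^ N := by
  induction p using MvPolynomial.induction_on with
  | C a => exact ⟨‖a‖, 0, norm_nonneg a, fun x => by simp [evalAt]⟩
  | add p q hp hq =>
    obtain ⟨C, N, hC, h⟩ := hp
    obtain ⟨D, M, hD, h'⟩ := hq
    refine ⟨C + D, max N M, add_nonneg hC hD, fun x => ?_⟩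
    have h1 : (1 : ℝ) ≤ 1 + ‖x‖ := by linarith [norm_nonneg x]
    have hN : (1 + ‖x‖) ^ N ≤ (1 + ‖x‖) ^ max N M := pow_le_pow_right₀ h1 (le_max_left _ _)
    have hM : (1 + ‖x‖) ^ M ≤ (1 + ‖x‖) ^ max N M := pow_le_pow_right₀ h1 (le_max_right _ _)
    have e : evalAt (p + q) x = evalAt p x + evalAt q x := by simp [evalAt]
    rw [e]
    calc ‖evalAt p x + evalAt q x‖ ≤ ‖evalAt p x‖ + ‖evalAt q x‖ := norm_add_le _ _
      _ ≤ C * (1 + ‖x‖) ^ N + D * (1 + ‖x‖) ^ M := add_le_add (h x) (h' x)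
      _ ≤ C * (1 + ‖x‖) ^ max N M + D * (1 + ‖x‖) ^ max N M := by gcongr
      _ = _ := by ring
  | mul_X p i hp =>
    obtain ⟨C, N, hC, h⟩ := hp
    refine ⟨C, N + 1, hC, fun x => ?_⟩
    have e : evalAt (p * MvPolynomial.X i) x = evalAt p x * ((x i : ℝ) : ℂ) := by simp [evalAt]
    have hx : ‖((x i : ℝ) : ℂ)‖ ≤ 1 + ‖x‖ := by
      rw [Complex.norm_real]
      linarith [PiLp.norm_apply_le x i]
    rw [e, norm_mul, pow_succ, ← mul_assoc]
    have := norm_nonneg x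
    exact mul_le_mul (h x) hx (norm_nonneg _) (by positivity)

/-- A polynomial times the Gaussian `e^{-|x|²/2}` is square integrable. -/
theorem memLp_evalAt_mul_gaussian {n : ℕ} (p : MvPolynomial (Fin n) ℂ) :
    MemLp (fun x : Rn n => evalAt p x * ((Real.exp (-‖x‖ ^ 2 / 2) : ℝ) : ℂ)) 2 volume := by
  obtain ⟨C, N, hC, h⟩ := evalAt_growth p
  have hg : MemLp (fun x : Rn n => Real.exp (-‖x‖ ^ 2 / 4)) 2 volume := by
    rw [memLp_two_iff_integrable_sq (by fun_prop)]
    have h2 := (GaussianFourier.integrable_cexp_neg_mul_sq_norm_add (V := Rn n)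
      (b := (1 / 2 : ℂ)) (by norm_num) 0 0).norm
    refine h2.congr (Filter.Eventually.of_forall fun x => ?_)
    simp only [Complex.norm_exp, ← Real.exp_nat_mul]
    congr 1
    have : (-(1 / 2 : ℂ) * (‖x‖ : ℂ) ^ 2 + 0 * ((inner ℝ (0 : Rn n) x : ℝ) : ℂ)) =
        ((-(1 / 2) * ‖x‖ ^ 2 : ℝ) : ℂ) := by push_cast; ring
    rw [this, Complex.ofReal_re]
    push_cast
    ring
  refine (hg.const_mul (C * (N.factorial * Real.exp 2))).of_le
    (((evalAt_continuous p).mul (by fun_prop)).aestronglyMeasurable)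
    (Filter.Eventually.of_forall fun x => ?_)
  have hr := norm_nonneg x
  have h1 : (1 + ‖x‖) ^ N ≤ N.factorial * Real.exp (1 + ‖x‖) := by
    have := Real.pow_div_factorial_le_exp (1 + ‖x‖) (by linarith) N
    rwa [div_le_iff₀' (by positivity)] at this
  have h2 : Real.exp (1 + ‖x‖) * Real.exp (-‖x‖ ^ 2 / 2) ≤
      Real.exp 2 * Real.exp (-‖x‖ ^ 2 / 4) := by
    rw [← Real.exp_add, ← Real.exp_add]
    exact Real.exp_le_exp.mpr (by nlinarith [sq_nonneg (‖x‖ / 2 - 1)])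
  rw [norm_mul, Complex.norm_real, Real.norm_of_nonneg (Real.exp_pos _).le,
    Real.norm_of_nonneg (by positivity)]
  calc ‖evalAt p x‖ * Real.exp (-‖x‖ ^ 2 / 2)
      ≤ C * (N.factorial * Real.exp (1 + ‖x‖)) * Real.exp (-‖x‖ ^ 2 / 2) := by
        gcongr
        exact (h x).trans (by gcongr)
    _ = C * N.factorial * (Real.exp (1 + ‖x‖) * Real.exp (-‖x‖ ^ 2 / 2)) := by ring
    _ ≤ C * N.factorial * (Real.exp 2 * Real.exp (-‖x‖ ^ 2 / 4)) := by gcongr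
    _ = _ := by ring

theorem hermiteFun_memLp {n : ℕ} (α : Fin n → ℕ) :
    MemLp (hermiteFun α : Rn n → ℂ) 2 volume := by
  let q : MvPolynomial (Fin n) ℂ := ∏ i : Fin n,
    (MvPolynomial.C (((√(2 ^ α i * ((α i).factorial : ℝ) * √Real.pi))⁻¹ * √2 ^ α i : ℝ) : ℂ) *
      Polynomial.aeval (MvPolynomial.C ((√2 : ℝ) : ℂ) * MvPolynomial.X i)
        (Polynomial.hermite (α i)))
  have key : (hermiteFun α : Rn n → ℂ) =
      fun x : Rn n => evalAt q x * ((Real.exp (-‖x‖ ^ 2 / 2) : ℝ) : ℂ) := by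
    funext x
    have hexp : Real.exp (-‖x‖ ^ 2 / 2) = ∏ i, Real.exp (-(x i) ^ 2 / 2) := by
      rw [← Real.exp_sum, EuclideanSpace.norm_sq_eq]
      congr 1
      rw [← Finset.sum_neg_distrib, Finset.sum_div]
      simp
    rw [hexp, hermiteFun, evalAt, map_prod, Complex.ofReal_prod, Complex.ofReal_prod,
      ← Finset.prod_mul_distrib]
    refine Finset.prod_congr rfl fun i _ => ?_
    have h1 : MvPolynomial.eval (fun i => ((x i : ℝ) : ℂ))
        (Polynomial.aeval (MvPolynomial.C ((√2 : ℝ) : ℂ) * MvPolynomial.X i)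
          (Polynomial.hermite (α i))) =
        ((Polynomial.aeval (√2 * x i) (Polynomial.hermite (α i)) : ℝ) : ℂ) := by
      have h2 := Polynomial.hom_eval₂ (Polynomial.hermite (α i)) (algebraMap ℤ ℝ) Complex.ofRealHom
        (√2 * x i)
      rw [Complex.ofRealHom_eq_coe] at h2
      rw [Polynomial.aeval_def, Polynomial.aeval_def, Polynomial.hom_eval₂, h2]
      congr 1
      · exact RingHom.ext_int _ _
      · rw [map_mul, MvPolynomial.eval_C, MvPolynomial.eval_X, Complex.ofRealHom_eq_coe,
          Complex.ofReal_mul]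
    rw [map_mul, h1, MvPolynomial.eval_C, hermiteFun1, hermitePoly]
    push_cast
    ring
  rw [key]
  exact memLp_evalAt_mul_gaussian q

theorem phiFun_memLp {n : ℕ} (Y : HarmonicBases n) (k s : ℕ) (j : Fin (harmonicDim n s)) :
    MemLp (phiFun Y k s j) 2 volume := by
  let β : ℝ := (n : ℝ) / 2 - 1 + s
  let q : MvPolynomial (Fin n) ℂ :=
    MvPolynomial.C ((√(2 * Real.Gamma (k + 1) / Real.Gamma (k + β + 1)) : ℝ) : ℂ) *
      (∑ i ∈ Finset.range (k + 1),
        MvPolynomial.C ((Real.Gamma (k + β + 1) / Real.Gamma (i + β + 1) *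
          (((i.factorial : ℝ) * ((k - i).factorial : ℝ)))⁻¹ : ℝ) : ℂ) *
        (-∑ l, MvPolynomial.X l ^ 2) ^ i) * (Y s j : MvPolynomial (Fin n) ℂ)
  have key : phiFun Y k s j =
      fun x : Rn n => evalAt q x * ((Real.exp (-‖x‖ ^ 2 / 2) : ℝ) : ℂ) := by
    funext x
    have hn : ((‖x‖ : ℝ) : ℂ) ^ 2 = ∑ l, ((x l : ℝ) : ℂ) ^ 2 := by
      rw [← Complex.ofReal_pow, EuclideanSpace.norm_sq_eq]
      simp
    simp only [phiFun, laguerreFun, laguerrePoly, evalAt, q, map_mul, map_sum, map_pow, map_neg,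
      MvPolynomial.eval_C, MvPolynomial.eval_X]
    rw [← hn]
    push_cast
    simp only [β, div_eq_mul_inv]
    rw [mul_right_comm]
    congr 3
    refine Finset.sum_congr rfl fun i _ => ?_
    ring
  rw [key]
  exact memLp_evalAt_mul_gaussian q

/-- `h_α` as an element of `L²(ℝⁿ)`. -/
def hermiteL2 {n : ℕ} (α : Fin n → ℕ) : L2 n := (hermiteFun_memLp α).toLp (hermiteFun α)

/-- `φ_{k,s,j}` as an element of `L²(ℝⁿ)`. -/
def phiL2 {n : ℕ} (Y : HarmonicBases n) (k s : ℕ) (j : Fin (harmonicDim n s)) : L2 n :=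
  (phiFun_memLp Y k s j).toLp (phiFun Y k s j)

/-- The set of triples `(k, s, j)` with `k, s ∈ ℕ` and `1 ≤ j ≤ d_s`. If `n = 1` then `d_s = 0` for
`s ≥ 2`, so that only `s = 0, 1` occur. -/
abbrev PhiIndex (n : ℕ) : Type := Σ ks : ℕ × ℕ, Fin (harmonicDim n ks.2)

/-- The system `{φ_{k,s,j}}` as a family indexed by the triples `(k, s, j)`. -/
def phiSystem {n : ℕ} (Y : HarmonicBases n) (t : PhiIndex n) : L2 n := phiL2 Y t.1.1 t.1.2 t.2

/-! ### Diagonal operators and the two realizations -/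

/-- The operator that is diagonal with respect to an orthonormal family `e` of a Hilbert space,
`A f = ∑ᵢ μᵢ ⟨f, eᵢ⟩ eᵢ`, with domain `{f : ∑ᵢ |μᵢ ⟨f, eᵢ⟩|² < ∞}`. (The second condition in the
domain makes the definition meaningful for any family `e`; it follows from the first one if `e` is
orthonormal, see `mem_diagonalOperator_domain`.) -/
def diagonalOperator {ι E : Type*} [NormedAddCommGroup E] [InnerProductSpace ℂ E]
    (e : ι → E) (μ : ι → ℝ) : E →ₗ.[ℂ] E where
  domain :=
    { carrier := {f | Summable (fun i => ‖(μ i : ℂ) * inner ℂ (e i) f‖ ^ 2) ∧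
        Summable (fun i => ((μ i : ℂ) * inner ℂ (e i) f) • e i)}
      zero_mem' := by simp
      add_mem' := by
        rintro f g ⟨hf, hf'⟩ ⟨hg, hg'⟩
        refine ⟨?_, ?_⟩
        · refine Summable.of_nonneg_of_le (fun i => by positivity) (fun i => ?_)
            ((hf.add hg).mul_left 2)
          rw [inner_add_right, mul_add]
          have := norm_add_le ((μ i : ℂ) * inner ℂ (e i) f) ((μ i : ℂ) * inner ℂ (e i) g)
          have h0 := norm_nonneg ((μ i : ℂ) * inner ℂ (e i) f + (μ i : ℂ) * inner ℂ (e i) g)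
          nlinarith [sq_nonneg (‖(μ i : ℂ) * inner ℂ (e i) f‖ - ‖(μ i : ℂ) * inner ℂ (e i) g‖)]
        · simpa only [inner_add_right, mul_add, add_smul] using hf'.add hg'
      smul_mem' := by
        rintro c f ⟨hf, hf'⟩
        refine ⟨?_, ?_⟩
        · refine (hf.mul_left (‖c‖ ^ 2)).congr fun i => ?_
          rw [inner_smul_right, mul_left_comm, norm_mul c, mul_pow]
        · refine (hf'.const_smul c).congr fun i => ?_
          rw [inner_smul_right, mul_left_comm, mul_smul c] }
  toFun :=
    { toFun := fun f => ∑' i, ((μ i : ℂ) * inner ℂ (e i) (f : E)) • e i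
      map_add' := by
        rintro ⟨f, hf, hf'⟩ ⟨g, hg, hg'⟩
        rw [← hf'.tsum_add hg']
        simp only [Submodule.coe_add, inner_add_right, mul_add, add_smul]
      map_smul' := by
        rintro c ⟨f, hf, hf'⟩
        rw [RingHom.id_apply, ← hf'.tsum_const_smul c]
        simp only [Submodule.coe_smul, inner_smul_right, mul_left_comm _ c, mul_smul c] }

theorem mem_diagonalOperator_domain {ι E : Type*} [NormedAddCommGroup E] [InnerProductSpace ℂ E]
    [CompleteSpace E] {e : ι → E} (he : Orthonormal ℂ e) (μ : ι → ℝ) (f : E) :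
    f ∈ (diagonalOperator e μ).domain ↔ Summable (fun i => ‖(μ i : ℂ) * inner ℂ (e i) f‖ ^ 2) := by
  refine ⟨fun h => h.1, fun h => ⟨h, ?_⟩⟩
  have := (he.orthogonalFamily.summable_iff_norm_sq_summable
    (fun i => (μ i : ℂ) * inner ℂ (e i) f)).mpr h
  simpa using this

/-- The operator `𝓗`: `𝓗 f = ∑_α (n + 2|α|) ⟨f, h_α⟩ h_α`. -/
def hermiteOperator (n : ℕ) : L2 n →ₗ.[ℂ] L2 n :=
  diagonalOperator (hermiteL2 (n := n)) (fun α => (n : ℝ) + 2 * ((∑ i, α i : ℕ) : ℝ))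

/-- The operator `𝓗̃`: `𝓗̃ f = ∑_{k,s,j} (n + 2(s + 2k)) ⟨f, φ_{k,s,j}⟩ φ_{k,s,j}`. -/
def polarOperator {n : ℕ} (Y : HarmonicBases n) : L2 n →ₗ.[ℂ] L2 n :=
  diagonalOperator (phiSystem Y) (fun t => (n : ℝ) + 2 * ((t.1.2 : ℝ) + 2 * (t.1.1 : ℝ)))

/-- The operator `A` on `L²(ℝⁿ)` extends the harmonic oscillator `H = -Δ + |x|²` with domain
`C_c^∞(ℝⁿ)`. -/
def ExtendsHarmonicOscillator {n : ℕ} (A : L2 n →ₗ.[ℂ] L2 n) : Prop :=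
  ∀ f : Rn n → ℂ, ContDiff ℝ ∞ f → HasCompactSupport f →
    ∃ u : A.domain, ((u : L2 n) : Rn n → ℂ) =ᵐ[volume] f ∧
      (A u : Rn n → ℂ) =ᵐ[volume] fun x => -(Laplacian.laplacian f x) + ((‖x‖ ^ 2 : ℝ) : ℂ) * f x

/-! ### Spectral projections and their kernels -/

/-- `Π_{n+2m} f = ∑_{|α| = m} ⟨f, h_α⟩ h_α`. -/
def hermiteProjection (n m : ℕ) : L2 n →L[ℂ] L2 n :=
  ∑ α ∈ Finset.piAntidiag (Finset.univ : Finset (Fin n)) m,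
    (innerSL ℂ (hermiteL2 α)).smulRight (hermiteL2 α)

/-- `Π̃_{n+2m} f = ∑_{0 ≤ k ≤ ⌊m/2⌋} ∑_{1 ≤ j ≤ d_{m-2k}} ⟨f, φ_{k,m-2k,j}⟩ φ_{k,m-2k,j}`. -/
def polarProjection {n : ℕ} (Y : HarmonicBases n) (m : ℕ) : L2 n →L[ℂ] L2 n :=
  ∑ k ∈ Finset.range (m / 2 + 1), ∑ j : Fin (harmonicDim n (m - 2 * k)),
    (innerSL ℂ (phiL2 Y k (m - 2 * k) j)).smulRight (phiL2 Y k (m - 2 * k) j)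

/-- The kernel `Φ_m(x, y) = ∑_{|α| = m} h_α(x) h_α(y)` of `Π_{n+2m}`. -/
def hermiteKernel (n m : ℕ) (x y : Rn n) : ℂ :=
  ∑ α ∈ Finset.piAntidiag (Finset.univ : Finset (Fin n)) m, hermiteFun α x * hermiteFun α y

/-- The kernel `Φ̃_m(x, y) = ∑_k ∑_j φ_{k,m-2k,j}(x) conj φ_{k,m-2k,j}(y)` of `Π̃_{n+2m}`. -/
def polarKernel {n : ℕ} (Y : HarmonicBases n) (m : ℕ) (x y : Rn n) : ℂ :=
  ∑ k ∈ Finset.range (m / 2 + 1), ∑ j : Fin (harmonicDim n (m - 2 * k)),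
    phiFun Y k (m - 2 * k) j x * star (phiFun Y k (m - 2 * k) j y)

end PolarOscillator

end

noncomputable section

namespace PolarOscillator

/-! ### Diagonal operators with respect to a Hilbert basis -/

section Diagonal

variable {ι κ E : Type*} [NormedAddCommGroup E] [InnerProductSpace ℂ E]

/-! Everything reduces to algebra on polynomials. Conjugated by the Gaussian $e^{-|x|^2/2}$, the
harmonic oscillator becomes $T+n$ with $T=\sum_i(2x_i\partial_i-\partial_i^2)$ (`oscillatorPoly`).
The Hermite polynomials of level $m$ are eigenvectors of $T$ for $2m$ (`oscillatorPoly_hermiteMv`),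
and so are the polynomials $L_k^\beta(|x|^2)Y$ with $Y$ harmonic of degree $s=m-2k$
(`laguerreMv_mem_eigenspace`).

The Hermite functions are orthonormal by one-dimensional integration by parts. Hence their
polynomial factors are independent, and counting monomials shows that they span all polynomials. It
follows that the $2m$-eigenspace of $T$ is exactly the span of the Hermite polynomials of level $m$,
and that distinct eigenspaces are orthogonal in the Gaussian-weighted $L^2$. This orthogonality is
used twice for the polar system: applied to solid harmonics it gives orthogonality on the sphere for
different degrees, and it handles different $k$ with equal $s$. Only the norm of a Laguerre function
has to be computed, in `integral_laguerreFun_sq`.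

Rank-nullity for the Laplacian gives at least as many indices $(k,m-2k,j)$ as multi-indices of
length $m$ (`card_piAntidiag_le_sum_harmonicDim`), so the polar polynomials of level $m$ span the
same eigenspace (`span_phiMv_eq_eigenspace`). Two orthonormal bases of one finite-dimensional space
define the same projection and the same kernel (`sum_star_smul_eq`), which settles the three claims
for each $m$.

Polynomials times the Gaussian are total in $L^2$ (`eq_zero_of_inner_gaussL2`), so both systems are
Hilbert bases. A diagonal operator with real eigenvalues is self-adjoint, and two of them agree as
soon as basis vectors with different eigenvalues are orthogonal
(`diagonalOperator_eq_of_orthogonal`). Integration by parts against Hermite functions shows that the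
Hermite operator extends $-\Delta+|x|^2$; the polar operator inherits this, being equal to it. -/

theorem hilbertBasis_ext_inner (b : HilbertBasis ι ℂ E) {v w : E}
    (h : ∀ i, inner ℂ (b i) v = inner ℂ (b i) w) : v = w := by
  apply b.repr.injective
  ext i
  rw [b.repr_apply_apply, b.repr_apply_apply, h]

theorem summable_norm_inner_sq (b : HilbertBasis ι ℂ E) (w : E) :
    Summable fun i => ‖inner ℂ (b i) w‖ ^ 2 := by
  have := (b.repr w).2.summable (by norm_num)
  simpa [b.repr_apply_apply] using this

theorem inner_diagonalOperator (b : HilbertBasis ι ℂ E) (μ : ι → ℝ)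
    (f : (diagonalOperator b μ).domain) (i : ι) :
    inner ℂ (b i) (diagonalOperator b μ f) = (μ i : ℂ) * inner ℂ (b i) (f : E) := by
  classical
  have h : HasSum (fun j => ((μ j : ℂ) * inner ℂ (b j) (f : E)) • b j)
    (diagonalOperator b μ f) := f.2.2.hasSum
  have h1 := h.mapL (innerSL ℂ (b i))
  refine h1.unique ?_
  have h2 : (fun j => innerSL ℂ (b i) (((μ j : ℂ) * inner ℂ (b j) (f : E)) • b j)) =
      fun j => if j = i then (μ i : ℂ) * inner ℂ (b i) (f : E) else 0 := by
    funext j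
    rw [innerSL_apply_apply, inner_smul_right, orthonormal_iff_ite.mp b.orthonormal]
    by_cases hij : j = i
    · simp [hij]
    · simp [hij, Ne.symm hij]
  rw [h2]
  exact hasSum_ite_eq i _

theorem diagonalOperator_eq_of_inner_eq (b : HilbertBasis ι ℂ E) (μ : ι → ℝ)
    {f : (diagonalOperator b μ).domain} {w : E}
    (h : ∀ i, inner ℂ (b i) w = (μ i : ℂ) * inner ℂ (b i) (f : E)) :
    diagonalOperator b μ f = w :=
  hilbertBasis_ext_inner b fun i => by rw [inner_diagonalOperator, h]

variable [CompleteSpace E]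

/-- A weak criterion for the domain: if some vector $w$ of the space has the coefficients that the
image of $f$ should have, their square summability comes for free from Parseval. -/
theorem mem_domain_of_inner_eq (b : HilbertBasis ι ℂ E) (μ : ι → ℝ) {f w : E}
    (h : ∀ i, inner ℂ (b i) w = (μ i : ℂ) * inner ℂ (b i) f) :
    f ∈ (diagonalOperator b μ).domain := by
  rw [mem_diagonalOperator_domain b.orthonormal]
  simpa only [h] using summable_norm_inner_sq b w

theorem basis_mem_domain (b : HilbertBasis ι ℂ E) (μ : ι → ℝ) (i : ι) :
    b i ∈ (diagonalOperator b μ).domain := by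
  classical
  refine mem_domain_of_inner_eq b μ (w := (μ i : ℂ) • b i) fun j => ?_
  rw [inner_smul_right, orthonormal_iff_ite.mp b.orthonormal]
  split_ifs with h
  · rw [h]
  · simp

theorem dense_diagonalOperator_domain (b : HilbertBasis ι ℂ E) (μ : ι → ℝ) :
    Dense ((diagonalOperator b μ).domain : Set E) := by
  have h1 : Dense (Submodule.span ℂ (Set.range b) : Set E) := by
    rw [Submodule.dense_iff_topologicalClosure_eq_top]
    exact b.dense_span
  refine h1.mono ?_
  rw [SetLike.coe_subset_coe, Submodule.span_le]
  rintro _ ⟨i, rfl⟩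
  exact basis_mem_domain b μ i

/-- Symmetry is Parseval together with the reality of $\mu$. Maximality follows by testing the
adjoint on basis vectors: this determines the coefficients of the image, so the weak criterion puts
every vector of the adjoint's domain into the original one. -/
theorem isSelfAdjoint_diagonalOperator (b : HilbertBasis ι ℂ E) (μ : ι → ℝ) :
    IsSelfAdjoint (diagonalOperator b μ) := by
  have hd := dense_diagonalOperator_domain b μ
  rw [LinearPMap.isSelfAdjoint_def]
  have hle : diagonalOperator b μ ≤ (diagonalOperator b μ).adjoint := by
    refine LinearPMap.IsFormalAdjoint.le_adjoint hd fun x y => ?_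
    rw [← b.tsum_inner_mul_inner, ← b.tsum_inner_mul_inner]
    refine tsum_congr fun i => ?_
    rw [← inner_conj_symm, inner_diagonalOperator, inner_diagonalOperator, map_mul,
      inner_conj_symm, Complex.conj_ofReal]
    ring
  refine (LinearPMap.eq_of_le_of_domain_eq hle (le_antisymm hle.1 fun y hy => ?_)).symm
  refine mem_domain_of_inner_eq b μ (w := (diagonalOperator b μ).adjoint ⟨y, hy⟩) fun i => ?_
  have h1 := LinearPMap.adjoint_isFormalAdjoint hd ⟨y, hy⟩ ⟨b i, basis_mem_domain b μ i⟩
  rw [← inner_conj_symm, h1, inner_conj_symm,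
    diagonalOperator_eq_of_inner_eq b μ (w := (μ i : ℂ) • b i), inner_smul_left,
    Complex.conj_ofReal]
  intro j
  classical
  rw [inner_smul_right, orthonormal_iff_ite.mp b.orthonormal]
  split_ifs with h
  · rw [h]
  · simp

/-- In the expansion of $\langle b_i, Af\rangle$ along $c$ only those $j$ with $\nu_j=\mu_i$
contribute, so $\mu_i$ can be pulled out of the sum, and the weak criterion for $b$ applies. -/
theorem diagonalOperator_le_of_orthogonal (b : HilbertBasis ι ℂ E) (c : HilbertBasis κ ℂ E)
    (μ : ι → ℝ) (ν : κ → ℝ) (h : ∀ i j, μ i ≠ ν j → inner ℂ (b i) (c j) = 0) :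
    diagonalOperator c ν ≤ diagonalOperator b μ := by
  have key : ∀ (f : (diagonalOperator c ν).domain) (i : ι),
      inner ℂ (b i) (diagonalOperator c ν f) = (μ i : ℂ) * inner ℂ (b i) (f : E) := by
    intro f i
    rw [← c.tsum_inner_mul_inner, ← c.tsum_inner_mul_inner, ← tsum_mul_left]
    refine tsum_congr fun j => ?_
    rw [inner_diagonalOperator]
    by_cases hij : μ i = ν j
    · rw [hij]; ring
    · simp [h i j hij]
  refine ⟨fun f hf => mem_domain_of_inner_eq b μ (key ⟨f, hf⟩), fun x y hxy => ?_⟩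
  refine (diagonalOperator_eq_of_inner_eq b μ fun i => ?_).symm
  rw [key x i, hxy]

theorem diagonalOperator_eq_of_orthogonal (b : HilbertBasis ι ℂ E) (c : HilbertBasis κ ℂ E)
    (μ : ι → ℝ) (ν : κ → ℝ) (h : ∀ i j, μ i ≠ ν j → inner ℂ (b i) (c j) = 0) :
    diagonalOperator b μ = diagonalOperator c ν :=
  le_antisymm
    (diagonalOperator_le_of_orthogonal c b ν μ fun j i hij => by
      rw [← inner_conj_symm, h i j (Ne.symm hij), map_zero])
    (diagonalOperator_le_of_orthogonal b c μ ν h)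

end Diagonal

/-! ### The harmonic oscillator on polynomials and the Hermite polynomials -/

section Algebra

open MvPolynomial

theorem derivative_hermite_succ (k : ℕ) :
    Polynomial.derivative (Polynomial.hermite (k + 1)) = (k + 1 : ℤ) • Polynomial.hermite k := by
  induction k with
  | zero => simp [Polynomial.hermite_succ]
  | succ k ih =>
    rw [Polynomial.hermite_succ (k + 1), map_sub, Polynomial.derivative_mul,
      Polynomial.derivative_X, ih, map_zsmul, Polynomial.hermite_succ k]
    simp only [zsmul_eq_mul]
    push_cast
    ring

/-- Combine the two ladder relations $He_{k+1}=X\,He_k-He_k'$ and $He_{k+1}'=(k+1)He_k$. -/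
theorem hermite_ode (k : ℕ) :
    Polynomial.X * Polynomial.derivative (Polynomial.hermite k) -
      Polynomial.derivative (Polynomial.derivative (Polynomial.hermite k)) =
        (k : ℤ) • Polynomial.hermite k := by
  cases k with
  | zero => simp
  | succ k =>
    rw [derivative_hermite_succ, map_zsmul, Polynomial.hermite_succ k]
    simp only [zsmul_eq_mul]
    push_cast
    ring

/-- The polynomial `T p = ∑ᵢ (2 xᵢ ∂ᵢ p - ∂ᵢ² p)`, so that
`(-Δ + |x|²) (p e^{-|x|²/2}) = (T p + n p) e^{-|x|²/2}`. -/
def oscillatorPoly (n : ℕ) : Module.End ℂ (MvPolynomial (Fin n) ℂ) :=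
  ∑ i, (2 : ℂ) • (LinearMap.mulLeft ℂ (X i) ∘ₗ (pderiv (R := ℂ) i).toLinearMap) - polyLaplacian n

variable {n : ℕ}

theorem polyLaplacian_apply (p : MvPolynomial (Fin n) ℂ) :
    polyLaplacian n p = ∑ i, pderiv i (pderiv i p) := by
  simp [polyLaplacian]

theorem oscillatorPoly_apply (p : MvPolynomial (Fin n) ℂ) :
    oscillatorPoly n p = ∑ i, (2 * (X i * pderiv i p) - pderiv i (pderiv i p)) := by
  simp only [oscillatorPoly, LinearMap.sub_apply, polyLaplacian_apply, Finset.sum_sub_distrib,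
    LinearMap.sum_apply]
  congr 1
  refine Finset.sum_congr rfl fun i _ => ?_
  simp [two_smul, two_mul]

/-- The polynomial `He_k(√2 xᵢ)`. -/
def hermiteVar (i : Fin n) (k : ℕ) : MvPolynomial (Fin n) ℂ :=
  Polynomial.aeval (C ((√2 : ℝ) : ℂ) * X i) (Polynomial.hermite k)

theorem pderiv_aeval_int (i : Fin n) (q : MvPolynomial (Fin n) ℂ) (p : Polynomial ℤ) :
    pderiv i (Polynomial.aeval q p) =
      Polynomial.aeval q (Polynomial.derivative p) * pderiv i q :=
  ((pderiv (R := ℂ) i).restrictScalars ℤ).map_aeval p q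

theorem C_sqrt_two_sq : (C ((√2 : ℝ) : ℂ) : MvPolynomial (Fin n) ℂ) * C ((√2 : ℝ) : ℂ) = 2 := by
  rw [← C_mul, ← Complex.ofReal_mul, Real.mul_self_sqrt (by norm_num)]
  exact_mod_cast map_ofNat C 2

/-- The Hermite equation under the substitution $\sqrt2\,x_i$: each derivative brings a factor
$\sqrt2$, which turns $x\partial-\partial^2$ into half of the $i$-th summand of $T$. -/
theorem hermiteVar_ode (i : Fin n) (k : ℕ) :
    2 * (X i * pderiv i (hermiteVar i k)) - pderiv i (pderiv i (hermiteVar i k)) =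
      (2 * k : ℂ) • hermiteVar i k := by
  have h := congrArg (Polynomial.aeval (C ((√2 : ℝ) : ℂ) * X i : MvPolynomial (Fin n) ℂ))
    (hermite_ode k)
  simp only [map_sub, map_mul, Polynomial.aeval_X, map_zsmul] at h
  have h2 := C_sqrt_two_sq (n := n)
  simp only [hermiteVar, pderiv_aeval_int, pderiv_mul, pderiv_C, pderiv_X_self, zero_mul, zero_add,
    mul_one, mul_zero, add_zero, smul_eq_C_mul, zsmul_eq_mul] at h ⊢
  have h3 : (C (2 * (k : ℂ)) : MvPolynomial (Fin n) ℂ) = 2 * (k : MvPolynomial (Fin n) ℂ) := by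
    rw [C_mul, map_natCast]
    congr 1
  rw [h3, mul_assoc, mul_assoc]
  push_cast at h
  rw [← h, h2]
  ring

theorem pderiv_hermiteVar_of_ne {i j : Fin n} (h : j ≠ i) (k : ℕ) :
    pderiv i (hermiteVar j k) = 0 := by
  simp [hermiteVar, pderiv_aeval_int, pderiv_X_of_ne h]

theorem pderiv_prod_eq_zero {i : Fin n} (s : Finset (Fin n)) (f : Fin n → MvPolynomial (Fin n) ℂ)
    (h : ∀ j ∈ s, pderiv i (f j) = 0) : pderiv i (∏ j ∈ s, f j) = 0 := by
  classical
  induction s using Finset.induction_on with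
  | empty => simp
  | insert a s ha ih =>
    rw [Finset.prod_insert ha, pderiv_mul, h a (Finset.mem_insert_self _ _),
      ih fun j hj => h j (Finset.mem_insert_of_mem hj), zero_mul, mul_zero, add_zero]

theorem totalDegree_hermiteVar_le (i : Fin n) (k : ℕ) : (hermiteVar i k).totalDegree ≤ k := by
  rw [hermiteVar, Polynomial.aeval_eq_sum_range, Polynomial.natDegree_hermite]
  refine totalDegree_finsetSum_le fun j hj => ?_
  have hj' : j ≤ k := Nat.lt_succ_iff.mp (Finset.mem_range.mp hj)
  refine (totalDegree_smul_le _ _).trans ((totalDegree_pow _ _).trans ?_)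
  have : (C ((√2 : ℝ) : ℂ) * X i : MvPolynomial (Fin n) ℂ).totalDegree ≤ 1 :=
    (totalDegree_mul _ _).trans (by simp)
  nlinarith

/-- The normalising constant of the Hermite function `h_k`. -/
def hermiteConst (k : ℕ) : ℝ := (√(2 ^ k * (k.factorial : ℝ) * √Real.pi))⁻¹ * √2 ^ k

/-- The polynomial `p` with `h_α = p e^{-|x|²/2}`. -/
def hermiteMv (α : Fin n → ℕ) : MvPolynomial (Fin n) ℂ :=
  ∏ i, (C ((hermiteConst (α i) : ℝ) : ℂ) * hermiteVar i (α i))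

/-- Separation of variables: the $i$-th summand of $T$ sees only the $i$-th factor of the product
and multiplies it by $2\alpha_i$. -/
theorem oscillatorPoly_hermiteMv (α : Fin n → ℕ) :
    oscillatorPoly n (hermiteMv α) = (2 * (∑ i, α i : ℕ) : ℂ) • hermiteMv α := by
  rw [oscillatorPoly_apply]
  have key : ∀ i, 2 * (X i * pderiv i (hermiteMv α)) - pderiv i (pderiv i (hermiteMv α)) =
      (2 * (α i : ℂ)) • hermiteMv α := by
    intro i
    have h0 : pderiv i (∏ j ∈ Finset.univ.erase i,
        (C ((hermiteConst (α j) : ℝ) : ℂ) * hermiteVar j (α j))) = 0 := by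
      refine pderiv_prod_eq_zero _ _ fun j hj => ?_
      rw [pderiv_C_mul, pderiv_hermiteVar_of_ne (Finset.ne_of_mem_erase hj), mul_zero]
    have h1 := hermiteVar_ode i (α i)
    rw [hermiteMv, ← Finset.mul_prod_erase _ _ (Finset.mem_univ i)]
    set R := ∏ j ∈ Finset.univ.erase i, (C ((hermiteConst (α j) : ℝ) : ℂ) * hermiteVar j (α j))
    simp only [pderiv_mul, pderiv_C, zero_mul, zero_add, h0, mul_zero, add_zero]
    simp only [smul_eq_C_mul] at h1 ⊢
    linear_combination (C ((hermiteConst (α i) : ℝ) : ℂ) * R) * h1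
  rw [Finset.sum_congr rfl fun i _ => key i, ← Finset.sum_smul, ← Finset.mul_sum]
  push_cast
  rfl

theorem totalDegree_hermiteMv_le (α : Fin n → ℕ) : (hermiteMv α).totalDegree ≤ ∑ i, α i := by
  refine (totalDegree_finsetProd _ _).trans (Finset.sum_le_sum fun i _ => ?_)
  refine (totalDegree_mul _ _).trans ?_
  simpa using totalDegree_hermiteVar_le i (α i)

/-- A linearly independent family in a subspace of at most the dimension of the number of its
members spans the subspace. -/
theorem span_range_eq_of_finrank_le_card {ι V : Type*} [Fintype ι] [AddCommGroup V] [Module ℂ V]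
    {v : ι → V} (hv : LinearIndependent ℂ v) (S : Submodule ℂ V) [FiniteDimensional ℂ S]
    (hS : ∀ i, v i ∈ S) (hc : Module.finrank ℂ S ≤ Fintype.card ι) :
    Submodule.span ℂ (Set.range v) = S := by
  refine Submodule.eq_of_le_of_finrank_le ?_ ?_
  · rw [Submodule.span_le]
    rintro _ ⟨i, rfl⟩
    exact hS i
  · rwa [finrank_span_eq_card hv]

/-- In total degree at most $M$ there are as many Hermite polynomials as monomials, so independence
forces them to span. Independence is supplied later, by orthonormality in $L^2$. -/
theorem span_hermiteMv_eq_top (h : LinearIndependent ℂ (hermiteMv (n := n))) :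
    Submodule.span ℂ (Set.range (hermiteMv (n := n))) = ⊤ := by
  rw [eq_top_iff]
  intro p _
  set M := p.totalDegree
  let S : Set (Fin n →₀ ℕ) := {α | α.degree ≤ M}
  let b : Module.Basis S ℂ (restrictTotalDegree (Fin n) ℂ M) := basisRestrictSupport ℂ S
  have : Fintype S := @Fintype.ofFinite _ (Module.Finite.finite_basis b)
  let v : S → MvPolynomial (Fin n) ℂ := fun α => hermiteMv (α : Fin n →₀ ℕ)
  have hv : LinearIndependent ℂ v :=
    h.comp (fun α : S => ((α : Fin n →₀ ℕ) : Fin n → ℕ))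
      (DFunLike.coe_injective.comp Subtype.coe_injective)
  have hspan := span_range_eq_of_finrank_le_card hv (restrictTotalDegree (Fin n) ℂ M)
    (fun α => by
      rw [mem_restrictTotalDegree]
      refine (totalDegree_hermiteMv_le _).trans ?_
      have := α.2
      simp only [S, Set.mem_ofPred_eq, Finsupp.degree_eq_sum] at this
      exact this)
    (Module.finrank_eq_card_basis b).le
  have hp : p ∈ restrictTotalDegree (Fin n) ℂ M := by rw [mem_restrictTotalDegree]
  rw [← hspan] at hp
  refine Submodule.span_mono ?_ hp
  rintro _ ⟨α, rfl⟩
  exact ⟨_, rfl⟩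

/-- The eigenspace of the oscillator for the eigenvalue `2m` is spanned by the Hermite polynomials
of level `m`. -/
theorem eigenspace_le_span_hermiteMv (h : LinearIndependent ℂ (hermiteMv (n := n))) (m : ℕ) :
    (oscillatorPoly n).eigenspace (2 * m : ℂ) ≤
      Submodule.span ℂ (hermiteMv '' {α : Fin n → ℕ | ∑ i, α i = m}) := by
  intro p hp
  rw [Module.End.mem_eigenspace_iff] at hp
  obtain ⟨c, rfl⟩ := (Finsupp.mem_span_range_iff_exists_finsupp).mp
    ((span_hermiteMv_eq_top h).ge (Submodule.mem_top (x := p)))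
  -- Applying $T-2m$ to the Hermite expansion of an eigenvector multiplies the coefficient of index
  -- $\alpha$ by $2|\alpha|-2m$; independence then leaves only $|\alpha|=m$.
  have hz : ∑ α ∈ c.support, (c α * (2 * (∑ i, α i : ℕ) - 2 * m)) • hermiteMv α = 0 := by
    rw [Finsupp.sum, map_sum, Finset.smul_sum, ← sub_eq_zero, ← Finset.sum_sub_distrib] at hp
    rw [← hp]
    refine Finset.sum_congr rfl fun α _ => ?_
    rw [map_smul, oscillatorPoly_hermiteMv]
    module
  have hc := linearIndependent_iff'.mp h _ _ hz
  refine Submodule.sum_mem _ fun α hα => Submodule.smul_mem _ _ (Submodule.subset_span ⟨α, ?_, rfl⟩)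
  have h2 := (mul_eq_zero.mp (hc α hα)).resolve_left (Finsupp.mem_support_iff.mp hα)
  have h3 : ((∑ i, α i : ℕ) : ℂ) = m := by linear_combination h2 / 2
  exact_mod_cast h3

end Algebra

/-! ### Laguerre polynomials times solid harmonics -/

section LaguerreAlgebra

open MvPolynomial

variable {n : ℕ}

/-- The polynomial `|x|²`. -/
def normSqMv (n : ℕ) : MvPolynomial (Fin n) ℂ := ∑ l, X l ^ 2

theorem isHomogeneous_normSqMv : (normSqMv n).IsHomogeneous 2 :=
  IsHomogeneous.sum _ _ _ fun i _ => isHomogeneous_X_pow i 2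

theorem pderiv_normSqMv (i : Fin n) : pderiv i (normSqMv n) = 2 * X i := by
  classical
  rw [normSqMv, map_sum, Finset.sum_eq_single i]
  · rw [pderiv_pow, pderiv_X_self]
    push_cast
    ring
  · intro j _ hj
    rw [pderiv_pow, pderiv_X_of_ne hj, mul_zero]
  · simp

theorem euler_identity {p : MvPolynomial (Fin n) ℂ} {s : ℕ} (hp : p.IsHomogeneous s) :
    ∑ i, X i * pderiv i p = (s : ℂ) • p := by
  rw [hp.sum_X_mul_pderiv, Nat.cast_smul_eq_nsmul]

/-- The Leibniz rule gives $\Delta|x|^2=2n$ as one term and the cross term $4\sum_i x_i\partial_i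
p$, which is $4sp$ by Euler's identity. -/
theorem polyLaplacian_normSqMv_mul {p : MvPolynomial (Fin n) ℂ} {s : ℕ} (hp : p.IsHomogeneous s) :
    polyLaplacian n (normSqMv n * p) =
      normSqMv n * polyLaplacian n p + (4 * s + 2 * n : ℂ) • p := by
  have h1 : ∀ i, pderiv i (pderiv i (normSqMv n * p)) =
      normSqMv n * pderiv i (pderiv i p) + ((4 : ℂ) • (X i * pderiv i p) + (2 : ℂ) • p) := by
    intro i
    have h2 : pderiv i (2 : MvPolynomial (Fin n) ℂ) = 0 := by
      have := (pderiv (R := ℂ) i).map_natCast 2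
      exact_mod_cast this
    have c2 : (C (2 : ℂ) : MvPolynomial (Fin n) ℂ) = 2 := map_ofNat C 2
    have c4 : (C (4 : ℂ) : MvPolynomial (Fin n) ℂ) = 4 := map_ofNat C 4
    simp only [pderiv_mul, pderiv_normSqMv, map_add, pderiv_X_self, h2, zero_mul, zero_add,
      mul_one, smul_eq_C_mul, c2, c4]
    ring
  simp only [polyLaplacian_apply, h1, Finset.sum_add_distrib, ← Finset.mul_sum, ← Finset.smul_sum,
    euler_identity hp]
  rw [Finset.sum_const, Finset.card_univ, Fintype.card_fin, ← Nat.cast_smul_eq_nsmul ℂ]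
  module

theorem isHomogeneous_normSqMv_pow_mul {Y : MvPolynomial (Fin n) ℂ} {s : ℕ}
    (hY : Y.IsHomogeneous s) (i : ℕ) : (normSqMv n ^ i * Y).IsHomogeneous (2 * i + s) :=
  (isHomogeneous_normSqMv.pow i).mul hY

theorem polyLaplacian_normSqMv_pow_mul {Y : MvPolynomial (Fin n) ℂ} {s : ℕ}
    (hY : Y.IsHomogeneous s) (hΔ : polyLaplacian n Y = 0) (i : ℕ) :
    polyLaplacian n (normSqMv n ^ (i + 1) * Y) =
      (2 * (i + 1) * (2 * (i + 1) + n - 2 + 2 * s) : ℂ) • (normSqMv n ^ i * Y) := by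
  induction i with
  | zero =>
    rw [zero_add, pow_one, polyLaplacian_normSqMv_mul hY, hΔ, mul_zero, zero_add, pow_zero, one_mul]
    congr 1
    push_cast
    ring
  | succ i ih =>
    rw [pow_succ' _ (i + 1), mul_assoc,
      polyLaplacian_normSqMv_mul (isHomogeneous_normSqMv_pow_mul hY _), ih, mul_smul_comm,
      ← mul_assoc, ← pow_succ', ← add_smul]
    congr 1
    push_cast
    ring

theorem oscillatorPoly_of_isHomogeneous {p : MvPolynomial (Fin n) ℂ} {s : ℕ}
    (hp : p.IsHomogeneous s) :
    oscillatorPoly n p = (2 * s : ℂ) • p - polyLaplacian n p := by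
  rw [oscillatorPoly_apply, Finset.sum_sub_distrib, ← Finset.mul_sum, euler_identity hp,
    polyLaplacian_apply, mul_smul, two_smul, two_mul]

/-- The coefficient of `t^i` in `L_k^β(t)`. -/
def laguerreCoeff (β : ℝ) (k i : ℕ) : ℝ :=
  Real.Gamma (k + β + 1) / Real.Gamma (i + β + 1) *
    ((-1) ^ i / ((i.factorial : ℝ) * ((k - i).factorial : ℝ)))

theorem laguerrePoly_eq (β : ℝ) (k : ℕ) (t : ℝ) :
    laguerrePoly β k t = ∑ i ∈ Finset.range (k + 1), laguerreCoeff β k i * t ^ i := by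
  refine Finset.sum_congr rfl fun i _ => ?_
  rw [laguerreCoeff, neg_pow]
  ring

/-- The Laguerre equation $ty''+(\beta+1-t)y'+ky=0$ read off coefficientwise. -/
theorem laguerreCoeff_succ {β : ℝ} (hβ : -1 < β) {k i : ℕ} (h : i < k) :
    ((i + 1) * (i + 1 + β)) * laguerreCoeff β k (i + 1) = -(k - i) * laguerreCoeff β k i := by
  have hi : (0 : ℝ) ≤ i := Nat.cast_nonneg i
  have h1 : Real.Gamma ((i + 1 : ℕ) + β + 1) = (i + 1 + β) * Real.Gamma (i + β + 1) := by
    rw [show ((i + 1 : ℕ) : ℝ) + β + 1 = (i + β + 1) + 1 by push_cast; ring,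
      Real.Gamma_add_one (by linarith)]
    ring
  have h2 : (k - i : ℝ) * ((k - (i + 1)).factorial : ℝ) = ((k - i).factorial : ℝ) := by
    obtain ⟨d, rfl⟩ := Nat.exists_eq_add_of_lt h
    rw [show i + d + 1 - (i + 1) = d by omega, show i + d + 1 - i = d + 1 by omega,
      Nat.factorial_succ]
    push_cast
    ring
  have h3 : Real.Gamma (i + β + 1) ≠ 0 := (Real.Gamma_pos_of_pos (by linarith)).ne'
  have h4 : ((k - (i + 1)).factorial : ℝ) ≠ 0 := by positivity
  have h5 : (k - i : ℝ) ≠ 0 := sub_ne_zero.mpr (by exact_mod_cast h.ne')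
  have h6 : (i + 1 + β : ℝ) ≠ 0 := by linarith
  rw [laguerreCoeff, laguerreCoeff, h1, ← h2, Nat.factorial_succ]
  push_cast
  field_simp
  ring

/-- The normalising constant of the Laguerre function `ℓ_k^β`. -/
def laguerreConst (β : ℝ) (k : ℕ) : ℝ := √(2 * Real.Gamma (k + 1) / Real.Gamma (k + β + 1))

/-- The polynomial `ℓ_k^{n/2-1+s}(|x|) Y(x) e^{|x|²/2}`. -/
def laguerreMv (k s : ℕ) (Y : MvPolynomial (Fin n) ℂ) : MvPolynomial (Fin n) ℂ :=
  ((laguerreConst ((n : ℝ) / 2 - 1 + s) k : ℝ) : ℂ) •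
    ∑ i ∈ Finset.range (k + 1),
      ((laguerreCoeff ((n : ℝ) / 2 - 1 + s) k i : ℝ) : ℂ) • (normSqMv n ^ i * Y)

/-- With $\beta=n/2-1+s$ one has $\Delta(|x|^{2(i+1)}Y)=4(i+1)(i+1+\beta)|x|^{2i}Y$. By the
coefficient recursion, $-\Delta$ then contributes $4(k-i)$ to the $i$-th term, on top of $2(2i+s)$
from homogeneity; the total $2(s+2k)$ is independent of $i$. -/
theorem laguerreMv_mem_eigenspace (hn : 1 ≤ n) {s : ℕ} {Y : MvPolynomial (Fin n) ℂ}
    (hY : Y ∈ SolidHarmonic n s) (k : ℕ) :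
    laguerreMv k s Y ∈ (oscillatorPoly n).eigenspace (2 * (s + 2 * k : ℕ) : ℂ) := by
  obtain ⟨hs, hΔ⟩ := hY
  replace hs : Y.IsHomogeneous s := hs
  replace hΔ : polyLaplacian n Y = 0 := hΔ
  refine Submodule.smul_mem _ _ ?_
  rw [Module.End.mem_eigenspace_iff]
  set β : ℝ := (n : ℝ) / 2 - 1 + s with hβdef
  have hn' : (1 : ℝ) ≤ n := by exact_mod_cast hn
  have hβ : -1 < β := by
    have : (0 : ℝ) ≤ s := Nat.cast_nonneg s
    rw [hβdef]; linarith
  have hT : ∀ i, oscillatorPoly n (normSqMv n ^ i * Y) =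
      (2 * (2 * i + s : ℕ) : ℂ) • (normSqMv n ^ i * Y) - polyLaplacian n (normSqMv n ^ i * Y) :=
    fun i => oscillatorPoly_of_isHomogeneous (isHomogeneous_normSqMv_pow_mul hs i)
  have hL : ∑ i ∈ Finset.range (k + 1),
      ((laguerreCoeff β k i : ℝ) : ℂ) • polyLaplacian n (normSqMv n ^ i * Y) =
      ∑ i ∈ Finset.range (k + 1),
        (-4 * (k - i) * (laguerreCoeff β k i : ℝ) : ℂ) • (normSqMv n ^ i * Y) := by
    -- The bottom term is split off on the left and the top term on the right. Both vanish, the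
    -- first because $Y$ is harmonic, the second through the factor $k-k$, and the rest matches
    -- after the index shift.
    rw [Finset.sum_range_succ', Finset.sum_range_succ]
    rw [pow_zero, one_mul, hΔ, smul_zero, sub_self, mul_zero, zero_mul, zero_smul]
    congr 1
    refine Finset.sum_congr rfl fun i hi => ?_
    rw [polyLaplacian_normSqMv_pow_mul hs hΔ, smul_smul]
    congr 1
    have h := congrArg (fun x : ℝ => (x : ℂ)) (laguerreCoeff_succ hβ (Finset.mem_range.mp hi))
    simp only [hβdef] at h ⊢
    push_cast at h ⊢
    linear_combination 4 * h
  rw [map_sum, Finset.smul_sum]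
  simp only [map_smul, hT, smul_sub]
  rw [Finset.sum_sub_distrib, hL, ← Finset.sum_sub_distrib]
  refine Finset.sum_congr rfl fun i _ => ?_
  push_cast
  module

/-! ### The number of solid harmonics -/

instance (m : ℕ) : FiniteDimensional ℂ (homogeneousSubmodule (Fin n) ℂ m) := by
  have h : homogeneousSubmodule (Fin n) ℂ m ≤ restrictTotalDegree (Fin n) ℂ m := by
    intro p hp
    rw [mem_restrictTotalDegree]
    exact ((mem_homogeneousSubmodule m p).mp hp).totalDegree_le
  exact Submodule.finiteDimensional_of_le h

theorem finrank_homogeneousSubmodule (n m : ℕ) :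
    Module.finrank ℂ (homogeneousSubmodule (Fin n) ℂ m) =
      (Finset.piAntidiag (Finset.univ : Finset (Fin n)) m).card := by
  have e : homogeneousSubmodule (Fin n) ℂ m = restrictSupport ℂ {α | α.degree = m} :=
    homogeneousSubmodule_eq_finsupp_supported _ _ m
  rw [e, Module.finrank_eq_nat_card_basis (basisRestrictSupport ℂ {α : Fin n →₀ ℕ | α.degree = m})]
  let f : ({α : Fin n →₀ ℕ | α.degree = m} : Set (Fin n →₀ ℕ)) ≃
      (Finset.piAntidiag (Finset.univ : Finset (Fin n)) m) :=
    Finsupp.equivFunOnFinite.subtypeEquiv fun α => by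
      simp [Finset.mem_piAntidiag, Finsupp.degree_eq_sum]
  rw [Nat.card_congr f, Nat.card_eq_fintype_card, Fintype.card_coe]

theorem polyLaplacian_isHomogeneous {m : ℕ} {p : MvPolynomial (Fin n) ℂ}
    (hp : p.IsHomogeneous (m + 2)) : (polyLaplacian n p).IsHomogeneous m := by
  rw [polyLaplacian_apply]
  exact IsHomogeneous.sum _ _ _ fun i _ => hp.pderiv.pderiv

/-- Rank-nullity for the Laplacian from degree $m+2$ to degree $m$. The inequality suffices, so
surjectivity of the Laplacian is not needed. -/
theorem finrank_homogeneousSubmodule_add_two_le (m : ℕ) :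
    Module.finrank ℂ (homogeneousSubmodule (Fin n) ℂ (m + 2)) ≤
      Module.finrank ℂ (homogeneousSubmodule (Fin n) ℂ m) + harmonicDim n (m + 2) := by
  let f := (polyLaplacian n).domRestrict (homogeneousSubmodule (Fin n) ℂ (m + 2))
  rw [← f.finrank_range_add_finrank_ker]
  refine add_le_add (Submodule.finrank_mono ?_) (le_of_eq ?_)
  · rintro _ ⟨p, rfl⟩
    exact polyLaplacian_isHomogeneous p.2
  · have h : Submodule.map (homogeneousSubmodule (Fin n) ℂ (m + 2)).subtype f.ker =
        SolidHarmonic n (m + 2) := by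
      ext p
      simp [f, SolidHarmonic, LinearMap.mem_ker, and_comm]
    rw [← Submodule.finrank_map_subtype_eq, h, harmonicDim]

theorem harmonicDim_eq_of_lt_two {m : ℕ} (hm : m < 2) :
    harmonicDim n m = Module.finrank ℂ (homogeneousSubmodule (Fin n) ℂ m) := by
  rw [harmonicDim, SolidHarmonic, inf_eq_left.mpr]
  intro p hp
  rw [mem_homogeneousSubmodule] at hp
  rw [LinearMap.mem_ker, polyLaplacian_apply]
  refine Finset.sum_eq_zero fun i _ => ?_
  have h1 : (pderiv i p).IsHomogeneous 0 := by
    have := hp.pderiv (i := i)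
    rwa [show m - 1 = 0 by omega] at this
  rw [← totalDegree_zero_iff_isHomogeneous, totalDegree_eq_zero_iff_eq_C] at h1
  rw [h1, pderiv_C]

/-- Descend in steps of two until the degree is below $2$, where every homogeneous polynomial is
harmonic. -/
theorem card_piAntidiag_le_sum_harmonicDim (n m : ℕ) :
    (Finset.piAntidiag (Finset.univ : Finset (Fin n)) m).card ≤
      ∑ k ∈ Finset.range (m / 2 + 1), harmonicDim n (m - 2 * k) := by
  rw [← finrank_homogeneousSubmodule]
  induction m using Nat.strong_induction_on with
  | _ m ih =>
    rcases lt_or_ge m 2 with hm | hm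
    · rw [← harmonicDim_eq_of_lt_two hm, show m / 2 = 0 by omega]
      simp
    · obtain ⟨l, rfl⟩ := Nat.exists_eq_add_of_le' hm
      rw [show (l + 2) / 2 + 1 = (l / 2 + 1) + 1 by omega, Finset.sum_range_succ']
      refine (finrank_homogeneousSubmodule_add_two_le l).trans ?_
      rw [mul_zero, Nat.sub_zero]
      refine add_le_add ((ih l (by omega)).trans (le_of_eq ?_)) le_rfl
      exact Finset.sum_congr rfl fun k _ => by rw [show l + 2 - 2 * (k + 1) = l - 2 * k by omega]

end LaguerreAlgebra

/-! ### Polynomials times the Gaussian -/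

section Gauss

open MvPolynomial

variable {n : ℕ}

/-- The function `p(x) e^{-|x|²/2}` on `ℝⁿ`, as a linear map in `p`. -/
def gaussFun (n : ℕ) : MvPolynomial (Fin n) ℂ →ₗ[ℂ] (Rn n → ℂ) where
  toFun p x := evalAt p x * ((Real.exp (-‖x‖ ^ 2 / 2) : ℝ) : ℂ)
  map_add' p q := by
    funext x
    simp [evalAt, add_mul]
  map_smul' c p := by
    funext x
    simp [evalAt, mul_assoc]

theorem gaussFun_apply (p : MvPolynomial (Fin n) ℂ) (x : Rn n) :
    gaussFun n p x = evalAt p x * ((Real.exp (-‖x‖ ^ 2 / 2) : ℝ) : ℂ) := rfl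

theorem gaussFun_memLp (p : MvPolynomial (Fin n) ℂ) : MemLp (gaussFun n p) 2 volume :=
  memLp_evalAt_mul_gaussian p

theorem continuous_gaussFun (p : MvPolynomial (Fin n) ℂ) : Continuous (gaussFun n p) :=
  (evalAt_continuous p).mul (by fun_prop)

/-- The class of `p(x) e^{-|x|²/2}` in `L²(ℝⁿ)`, as a linear map in `p`. -/
def gaussL2 (n : ℕ) : MvPolynomial (Fin n) ℂ →ₗ[ℂ] L2 n where
  toFun p := (gaussFun_memLp p).toLp (gaussFun n p)
  map_add' p q := by
    rw [← MemLp.toLp_add]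
    congr 1
    exact map_add _ _ _
  map_smul' c p := by
    rw [RingHom.id_apply, ← MemLp.toLp_const_smul]
    congr 1
    exact map_smul _ _ _

theorem gaussL2_apply (p : MvPolynomial (Fin n) ℂ) :
    gaussL2 n p = (gaussFun_memLp p).toLp (gaussFun n p) := rfl

theorem coeFn_gaussL2 (p : MvPolynomial (Fin n) ℂ) : gaussL2 n p =ᵐ[volume] gaussFun n p :=
  (gaussFun_memLp p).coeFn_toLp

theorem inner_gaussL2 (p : MvPolynomial (Fin n) ℂ) (f : L2 n) :
    inner ℂ (gaussL2 n p) f = ∫ x, star (gaussFun n p x) * f x := by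
  rw [L2.inner_def]
  refine integral_congr_ae ?_
  filter_upwards [coeFn_gaussL2 p] with x hx
  rw [hx, RCLike.inner_apply, mul_comm]
  rfl

theorem inner_gaussL2_gaussL2 (p q : MvPolynomial (Fin n) ℂ) :
    inner ℂ (gaussL2 n p) (gaussL2 n q) = ∫ x, star (gaussFun n p x) * gaussFun n q x := by
  rw [inner_gaussL2]
  refine integral_congr_ae ?_
  filter_upwards [coeFn_gaussL2 q] with x hx
  rw [hx]

theorem gaussFun_hermiteMv (α : Fin n → ℕ) : gaussFun n (hermiteMv α) = hermiteFun α := by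
  funext x
  have hexp : Real.exp (-‖x‖ ^ 2 / 2) = ∏ i, Real.exp (-(x i) ^ 2 / 2) := by
    rw [← Real.exp_sum, EuclideanSpace.norm_sq_eq]
    congr 1
    rw [← Finset.sum_neg_distrib, Finset.sum_div]
    simp
  rw [gaussFun_apply, hexp, hermiteFun, evalAt, hermiteMv, map_prod, Complex.ofReal_prod,
    Complex.ofReal_prod, ← Finset.prod_mul_distrib]
  refine Finset.prod_congr rfl fun i _ => ?_
  have h1 : MvPolynomial.eval (fun i => ((x i : ℝ) : ℂ)) (hermiteVar i (α i)) =
      ((Polynomial.aeval (√2 * x i) (Polynomial.hermite (α i)) : ℝ) : ℂ) := by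
    have h2 := Polynomial.hom_eval₂ (Polynomial.hermite (α i)) (algebraMap ℤ ℝ) Complex.ofRealHom
      (√2 * x i)
    rw [Complex.ofRealHom_eq_coe] at h2
    rw [hermiteVar, Polynomial.aeval_def, Polynomial.aeval_def, Polynomial.hom_eval₂, h2]
    congr 1
    · exact RingHom.ext_int _ _
    · rw [map_mul, MvPolynomial.eval_C, MvPolynomial.eval_X, Complex.ofRealHom_eq_coe,
        Complex.ofReal_mul]
  rw [map_mul, h1, MvPolynomial.eval_C, hermiteFun1, hermitePoly, hermiteConst]
  push_cast
  ring

theorem gaussL2_hermiteMv (α : Fin n → ℕ) : gaussL2 n (hermiteMv α) = hermiteL2 α := by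
  simp only [gaussL2_apply, hermiteL2, gaussFun_hermiteMv]

theorem evalAt_normSqMv (x : Rn n) : evalAt (normSqMv n) x = ((‖x‖ ^ 2 : ℝ) : ℂ) := by
  rw [EuclideanSpace.norm_sq_eq]
  simp [evalAt, normSqMv]

theorem evalAt_laguerreMv (k s : ℕ) (p : MvPolynomial (Fin n) ℂ) (x : Rn n) :
    evalAt (laguerreMv k s p) x = ((laguerreConst ((n : ℝ) / 2 - 1 + s) k *
      laguerrePoly ((n : ℝ) / 2 - 1 + s) k (‖x‖ ^ 2) : ℝ) : ℂ) * evalAt p x := by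
  have h := evalAt_normSqMv x
  rw [evalAt] at h
  simp only [evalAt, laguerreMv, laguerrePoly_eq, smul_eval, map_sum, map_mul, map_pow, h]
  push_cast
  rw [mul_assoc, Finset.sum_mul]
  simp only [mul_assoc]

theorem gaussFun_laguerreMv (Y : HarmonicBases n) (k s : ℕ) (j : Fin (harmonicDim n s)) :
    gaussFun n (laguerreMv k s (Y s j : MvPolynomial (Fin n) ℂ)) = phiFun Y k s j := by
  funext x
  rw [gaussFun_apply, evalAt_laguerreMv, phiFun, laguerreFun, laguerreConst]
  push_cast
  ring

theorem gaussL2_laguerreMv (Y : HarmonicBases n) (k s : ℕ) (j : Fin (harmonicDim n s)) :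
    gaussL2 n (laguerreMv k s (Y s j : MvPolynomial (Fin n) ℂ)) = phiL2 Y k s j := by
  simp only [gaussL2_apply, phiL2, gaussFun_laguerreMv]

end Gauss

/-! ### Orthonormality of the Hermite functions -/

section HermiteOrthonormal

theorem integrable_polynomial_mul_gaussian (p : Polynomial ℝ) :
    Integrable fun x : ℝ => p.eval x * Real.exp (-(x ^ 2) / 2) := by
  have h : (fun x : ℝ => p.eval x * Real.exp (-(x ^ 2) / 2)) =
      fun x => ∑ i ∈ Finset.range (p.natDegree + 1),
        p.coeff i * (x ^ (i : ℝ) * Real.exp (-(1 / 2) * x ^ 2)) := by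
    funext x
    rw [Polynomial.eval_eq_sum_range, Finset.sum_mul]
    refine Finset.sum_congr rfl fun i _ => ?_
    rw [Real.rpow_natCast, mul_assoc]
    congr 3
    ring
  rw [h]
  refine integrable_finsetSum _ fun i _ => Integrable.const_mul ?_ _
  exact integrable_rpow_mul_exp_neg_mul_sq (by norm_num) (by
    have : (0 : ℝ) ≤ i := Nat.cast_nonneg i
    linarith)

theorem integral_gaussian_by_parts (p : Polynomial ℝ) :
    ∫ x : ℝ, (Polynomial.X * p).eval x * Real.exp (-(x ^ 2) / 2) =
      ∫ x : ℝ, p.derivative.eval x * Real.exp (-(x ^ 2) / 2) := by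
  rw [← sub_eq_zero, ← integral_sub (integrable_polynomial_mul_gaussian _)
    (integrable_polynomial_mul_gaussian _)]
  have hd : ∀ x : ℝ, HasDerivAt (fun x => -(p.eval x * Real.exp (-(x ^ 2) / 2)))
      ((Polynomial.X * p).eval x * Real.exp (-(x ^ 2) / 2) -
        p.derivative.eval x * Real.exp (-(x ^ 2) / 2)) x := by
    intro x
    have h1 : HasDerivAt (fun x : ℝ => -(x ^ 2) / 2) (-x) x := by
      refine ((hasDerivAt_pow 2 x).neg.div_const 2).congr_deriv ?_
      push_cast
      ring
    refine ((p.hasDerivAt x).mul h1.exp).neg.congr_deriv ?_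
    rw [Polynomial.eval_mul, Polynomial.eval_X]
    ring
  exact integral_eq_zero_of_hasDerivAt_of_integrable hd
    ((integrable_polynomial_mul_gaussian _).sub (integrable_polynomial_mul_gaussian _))
    (integrable_polynomial_mul_gaussian _).neg

/-- The (probabilists') Hermite polynomial with real coefficients. -/
def hermiteReal (k : ℕ) : Polynomial ℝ := (Polynomial.hermite k).map (algebraMap ℤ ℝ)

theorem hermiteReal_zero : hermiteReal 0 = 1 := by simp [hermiteReal]

theorem hermiteReal_succ (k : ℕ) :
    hermiteReal (k + 1) = Polynomial.X * hermiteReal k - (hermiteReal k).derivative := by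
  simp [hermiteReal, Polynomial.hermite_succ, Polynomial.derivative_map]

theorem derivative_hermiteReal_succ (k : ℕ) :
    (hermiteReal (k + 1)).derivative = (k + 1 : ℝ) • hermiteReal k := by
  rw [hermiteReal, Polynomial.derivative_map, derivative_hermite_succ, hermiteReal]
  simp [Polynomial.smul_eq_C_mul]

/-- The raising operator $X-\partial$ is the adjoint of $\partial$ for the Gaussian weight.
Iterating this yields orthogonality and the norms $k!\sqrt{2\pi}$. -/
theorem integral_hermiteReal_succ_mul (k : ℕ) (q : Polynomial ℝ) :
    ∫ x : ℝ, (hermiteReal (k + 1) * q).eval x * Real.exp (-(x ^ 2) / 2) =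
      ∫ x : ℝ, (hermiteReal k * q.derivative).eval x * Real.exp (-(x ^ 2) / 2) := by
  have h := integral_gaussian_by_parts (hermiteReal k * q)
  rw [Polynomial.derivative_mul] at h
  have e1 : ∀ x : ℝ, (hermiteReal (k + 1) * q).eval x * Real.exp (-(x ^ 2) / 2) =
      (Polynomial.X * (hermiteReal k * q)).eval x * Real.exp (-(x ^ 2) / 2) -
        ((hermiteReal k).derivative * q).eval x * Real.exp (-(x ^ 2) / 2) := by
    intro x
    rw [hermiteReal_succ]
    simp
    ring
  have e2 : ∀ x : ℝ, ((hermiteReal k).derivative * q + hermiteReal k * q.derivative).eval x *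
      Real.exp (-(x ^ 2) / 2) = ((hermiteReal k).derivative * q).eval x * Real.exp (-(x ^ 2) / 2) +
        (hermiteReal k * q.derivative).eval x * Real.exp (-(x ^ 2) / 2) := by
    intro x
    rw [Polynomial.eval_add, add_mul]
  simp only [e1]
  simp only [e2] at h
  rw [integral_sub (integrable_polynomial_mul_gaussian _) (integrable_polynomial_mul_gaussian _),
    h, integral_add (integrable_polynomial_mul_gaussian _) (integrable_polynomial_mul_gaussian _),
    add_sub_cancel_left]

theorem integral_hermiteReal_mul (k l : ℕ) :
    ∫ x : ℝ, (hermiteReal k * hermiteReal l).eval x * Real.exp (-(x ^ 2) / 2) =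
      if k = l then (k.factorial : ℝ) * √(2 * Real.pi) else 0 := by
  induction k generalizing l with
  | zero =>
    cases l with
    | zero =>
      have h := integral_gaussian (1 / 2)
      simp only [hermiteReal_zero, mul_one, Polynomial.eval_one, one_mul, if_true,
        Nat.factorial_zero, Nat.cast_one]
      rw [show 2 * Real.pi = Real.pi / (1 / 2) by ring, ← h]
      refine integral_congr_ae (Filter.Eventually.of_forall fun x => ?_)
      simp only
      congr 1
      ring
    | succ l =>
      rw [mul_comm (hermiteReal 0), integral_hermiteReal_succ_mul, hermiteReal_zero]
      simp
  | succ k ih =>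
    rw [integral_hermiteReal_succ_mul]
    cases l with
    | zero => simp [hermiteReal_zero]
    | succ l =>
      rw [derivative_hermiteReal_succ]
      simp only [mul_smul_comm, Polynomial.eval_smul, smul_eq_mul, mul_assoc]
      rw [integral_const_mul, ih l]
      by_cases h : k = l
      · subst h
        simp [Nat.factorial_succ]
        ring
      · simp [h]

theorem hermiteFun1_eq (k : ℕ) (x : ℝ) :
    hermiteFun1 k x = hermiteConst k * (hermiteReal k).eval (√2 * x) * Real.exp (-x ^ 2 / 2) := by
  rw [hermiteFun1, hermitePoly, hermiteConst, hermiteReal, Polynomial.eval_map, Polynomial.aeval_def]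
  ring

/-- The substitution $y=\sqrt2\,x$ passes to the probabilists' weight $e^{-y^2/2}$. Its Jacobian
$1/\sqrt2$ turns $\sqrt{2\pi}$ into $\sqrt\pi$, as the normalisation requires. -/
theorem integral_hermiteFun1_mul (k l : ℕ) :
    ∫ x : ℝ, hermiteFun1 k x * hermiteFun1 l x = if k = l then 1 else 0 := by
  have e : ∀ x : ℝ, hermiteFun1 k x * hermiteFun1 l x = (hermiteConst k * hermiteConst l) *
      (fun y : ℝ => (hermiteReal k * hermiteReal l).eval y * Real.exp (-(y ^ 2) / 2)) (√2 * x) := by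
    intro x
    have h : Real.exp (-x ^ 2 / 2) * Real.exp (-x ^ 2 / 2) = Real.exp (-((√2 * x) ^ 2) / 2) := by
      rw [← Real.exp_add, mul_pow, Real.sq_sqrt (by norm_num)]
      congr 1
      ring
    simp only [hermiteFun1_eq, Polynomial.eval_mul, ← h]
    ring
  simp only [e]
  rw [integral_const_mul, Measure.integral_comp_mul_left
    (fun y : ℝ => (hermiteReal k * hermiteReal l).eval y * Real.exp (-(y ^ 2) / 2)),
    integral_hermiteReal_mul]
  split_ifs with h
  · subst h
    have hk : (0 : ℝ) < k.factorial := by positivity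
    have h2 : (√2 : ℝ) ≠ 0 := by positivity
    have hp : √Real.pi ≠ 0 := by positivity
    have hs : hermiteConst k * hermiteConst k = (k.factorial * √Real.pi)⁻¹ := by
      rw [hermiteConst, mul_mul_mul_comm, ← mul_inv, Real.mul_self_sqrt (by positivity),
        ← mul_pow, Real.mul_self_sqrt (by norm_num)]
      field_simp
    rw [hs, abs_of_nonneg (by positivity), smul_eq_mul, Real.sqrt_mul (by norm_num)]
    field_simp
  · simp

variable {n : ℕ}

theorem integral_prod_coordinates (f : Fin n → ℝ → ℝ) :
    ∫ x : Rn n, ∏ i, f i (x i) = ∏ i, ∫ t, f i t := by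
  rw [← integral_fintype_prod_volume_eq_prod (fun i => f i)]
  exact (EuclideanSpace.volume_preserving_symm_measurableEquiv_toLp (Fin n)).integral_comp'
    (g := fun y : Fin n → ℝ => ∏ i, f i (y i))

theorem orthonormal_hermiteL2 : Orthonormal ℂ (hermiteL2 (n := n)) := by
  classical
  rw [orthonormal_iff_ite]
  intro α β
  rw [← gaussL2_hermiteMv, ← gaussL2_hermiteMv, inner_gaussL2_gaussL2, gaussFun_hermiteMv,
    gaussFun_hermiteMv]
  have e : ∀ x : Rn n, star (hermiteFun α x) * hermiteFun β x =
      ((∏ i, hermiteFun1 (α i) (x i) * hermiteFun1 (β i) (x i) : ℝ) : ℂ) := by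
    intro x
    rw [hermiteFun, hermiteFun, Finset.prod_mul_distrib, Complex.ofReal_mul]
    congr 1
    exact Complex.conj_ofReal _
  simp only [e]
  rw [integral_complex_ofReal,
    integral_prod_coordinates (fun i t => hermiteFun1 (α i) t * hermiteFun1 (β i) t)]
  simp only [integral_hermiteFun1_mul]
  by_cases h : α = β
  · simp [h]
  · obtain ⟨i, hi⟩ := Function.ne_iff.mp h
    rw [if_neg h, Finset.prod_eq_zero (Finset.mem_univ i) (by simp [hi])]
    simp

theorem linearIndependent_hermiteMv : LinearIndependent ℂ (hermiteMv (n := n)) := by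
  refine LinearIndependent.of_comp (gaussL2 n) ?_
  have h : gaussL2 n ∘ hermiteMv = hermiteL2 := funext gaussL2_hermiteMv
  rw [h]
  exact orthonormal_hermiteL2.linearIndependent

end HermiteOrthonormal

/-! ### Integrals of Laguerre functions -/

section LaguerreIntegral

theorem Gamma_add_nat {x : ℝ} (hx : 0 < x) (i : ℕ) :
    Real.Gamma (x + i) = Real.Gamma x * (ascPochhammer ℝ i).eval x := by
  induction i with
  | zero => simp
  | succ i ih =>
    have : (0 : ℝ) ≤ i := Nat.cast_nonneg i
    rw [Nat.cast_succ, ← add_assoc, Real.Gamma_add_one (by linarith), ih, ascPochhammer_succ_eval]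
    ring

/-- These are, up to a factor, the moments of $L_k^\beta$. Since
$\Gamma(j+i+\beta+1)/\Gamma(j+\beta+1)$ is a monic polynomial of degree $i$ in $j$, the sum is a
multiple of its $k$-th forward difference at $0$: zero for $i<k$, and $k!$ times the factor for
$i=k$. -/
theorem sum_laguerreCoeff_mul_Gamma {β : ℝ} (hβ : -1 < β) {k i : ℕ} (hi : i ≤ k) :
    ∑ j ∈ Finset.range (k + 1), laguerreCoeff β k j * Real.Gamma ((j + i : ℕ) + β + 1) =
      if i = k then (-1) ^ k * Real.Gamma (k + β + 1) else 0 := by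
  set Q : Polynomial ℝ := (ascPochhammer ℝ i).comp (Polynomial.X + Polynomial.C (β + 1))
  have hdeg : Q.natDegree = i := by
    rw [Polynomial.natDegree_comp, ascPochhammer_natDegree, Polynomial.natDegree_X_add_C, mul_one]
  have hlead : Q.leadingCoeff = 1 := by
    have h : Q.Monic := (monic_ascPochhammer ℝ i).comp (Polynomial.monic_X_add_C _)
      (by rw [Polynomial.natDegree_X_add_C]; exact one_ne_zero)
    exact h
  have hsum : ∑ j ∈ Finset.range (k + 1),
      laguerreCoeff β k j * Real.Gamma ((j + i : ℕ) + β + 1) =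
      (-1) ^ k * (Real.Gamma (k + β + 1) / k.factorial) * (fwdDiff 1)^[k] Q.eval 0 := by
    rw [fwdDiff_iter_eq_sum_shift, Finset.mul_sum]
    refine Finset.sum_congr rfl fun j hj => ?_
    have hjk : j ≤ k := Nat.lt_succ_iff.mp (Finset.mem_range.mp hj)
    have hj0 : (0 : ℝ) ≤ j := Nat.cast_nonneg j
    have hG : Real.Gamma (j + β + 1) ≠ 0 := (Real.Gamma_pos_of_pos (by linarith)).ne'
    have e1 : Real.Gamma ((j + i : ℕ) + β + 1) = Real.Gamma (j + β + 1) * Q.eval (j : ℝ) := by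
      rw [show ((j + i : ℕ) : ℝ) + β + 1 = (j + β + 1) + i by push_cast; ring,
        Gamma_add_nat (by linarith)]
      simp only [Q, Polynomial.eval_comp, Polynomial.eval_add, Polynomial.eval_X,
        Polynomial.eval_C, add_assoc]
    have e2 : ((-1 : ℝ) ^ k) * (-1) ^ (k - j) = (-1) ^ j := by
      obtain ⟨d, rfl⟩ := Nat.exists_eq_add_of_le hjk
      rw [Nat.add_sub_cancel_left, pow_add, mul_assoc, ← pow_add, ← two_mul, pow_mul]
      simp
    have e3 : ((k.choose j : ℕ) : ℝ) = k.factorial / (j.factorial * (k - j).factorial) :=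
      Nat.cast_choose ℝ hjk
    rw [e1, laguerreCoeff, zsmul_eq_mul, nsmul_one, zero_add, ← e2]
    push_cast
    rw [e3]
    have h1 : ((k - j).factorial : ℝ) ≠ 0 := by positivity
    field_simp
  rw [hsum]
  split_ifs with h
  · have h2 := Polynomial.fwdDiff_iter_degree_eq_factorial Q
    rw [hdeg, hlead, h] at h2
    rw [h2]
    have : (k.factorial : ℝ) ≠ 0 := by positivity
    simp
    field_simp
  · rw [Polynomial.fwdDiff_iter_eq_zero_of_degree_lt (by omega)]
    simp

theorem integral_radial_monomial {β : ℝ} (hβ : -1 < β) (a : ℕ) :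
    ∫ r in Set.Ioi (0 : ℝ), r ^ (2 * β + 1) * (r ^ (2 * a) * Real.exp (-r ^ 2)) =
      Real.Gamma (a + β + 1) / 2 := by
  have ha : (0 : ℝ) ≤ a := Nat.cast_nonneg a
  have h := integral_rpow_mul_exp_neg_rpow (p := 2) (q := 2 * β + 1 + 2 * a) (by norm_num)
    (by linarith)
  rw [show (2 * β + 1 + 2 * a + 1) / 2 = a + β + 1 by ring] at h
  rw [div_eq_inv_mul, ← one_div, ← h]
  refine setIntegral_congr_fun measurableSet_Ioi fun r hr => ?_
  have hr' : (0 : ℝ) < r := hr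
  rw [Real.rpow_add hr' (2 * β + 1), Real.rpow_two, mul_assoc]
  congr 2
  rw [← Real.rpow_natCast r (2 * a)]
  push_cast
  rfl

theorem integrable_radial_monomial {β : ℝ} (hβ : -1 < β) (a : ℕ) :
    IntegrableOn (fun r : ℝ => r ^ (2 * β + 1) * (r ^ (2 * a) * Real.exp (-r ^ 2)))
      (Set.Ioi 0) := by
  -- The Bochner integral of a non-integrable function is $0$ by convention, whereas the value
  -- already found is positive.
  by_contra hc
  have h := integral_radial_monomial hβ a
  rw [integral_undef hc] at h
  have ha : (0 : ℝ) ≤ a := Nat.cast_nonneg a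
  have := Real.Gamma_pos_of_pos (s := a + β + 1) (by linarith)
  linarith

/-- Expand both Laguerre factors. The inner sum over $j$ is a moment that vanishes unless $i=k$, so
only the leading coefficient $(-1)^k/k!$ of the other factor survives. -/
theorem integral_laguerreFun_sq {β : ℝ} (hβ : -1 < β) (k : ℕ) :
    ∫ r in Set.Ioi (0 : ℝ), r ^ (2 * β + 1) * laguerreFun β k r ^ 2 = 1 := by
  have hk : (0 : ℝ) ≤ k := Nat.cast_nonneg k
  have hG : 0 < Real.Gamma (k + β + 1) := Real.Gamma_pos_of_pos (by linarith)
  have hf : (0 : ℝ) < k.factorial := by positivity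
  have e : ∀ r : ℝ, r ^ (2 * β + 1) * laguerreFun β k r ^ 2 =
      ∑ i ∈ Finset.range (k + 1), ∑ j ∈ Finset.range (k + 1),
        (2 * Real.Gamma (k + 1) / Real.Gamma (k + β + 1) *
          (laguerreCoeff β k i * laguerreCoeff β k j)) *
          (r ^ (2 * β + 1) * (r ^ (2 * (j + i)) * Real.exp (-r ^ 2))) := by
    intro r
    have h1 : Real.exp (-r ^ 2 / 2) ^ 2 = Real.exp (-r ^ 2) := by
      rw [← Real.exp_nat_mul]
      congr 1
      push_cast
      ring
    have h2 : laguerrePoly β k (r ^ 2) ^ 2 =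
        ∑ i ∈ Finset.range (k + 1), ∑ j ∈ Finset.range (k + 1),
          (laguerreCoeff β k i * laguerreCoeff β k j) * r ^ (2 * (j + i)) := by
      rw [sq (laguerrePoly β k (r ^ 2)), laguerrePoly_eq, Finset.sum_mul_sum]
      refine Finset.sum_congr rfl fun i _ => Finset.sum_congr rfl fun j _ => ?_
      rw [mul_add, pow_add, pow_mul, pow_mul]
      ring
    rw [laguerreFun, mul_pow, mul_pow, h1, h2,
      Real.sq_sqrt (div_nonneg (by rw [Real.Gamma_nat_eq_factorial]; positivity) hG.le)]
    simp only [Finset.mul_sum, Finset.sum_mul]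
    refine Finset.sum_congr rfl fun i _ => Finset.sum_congr rfl fun j _ => ?_
    ring
  simp only [e]
  have hint : ∀ (c : ℝ) (a : ℕ), Integrable (fun r : ℝ =>
      c * (r ^ (2 * β + 1) * (r ^ (2 * a) * Real.exp (-r ^ 2))))
      (volume.restrict (Set.Ioi 0)) := fun c a => (integrable_radial_monomial hβ a).const_mul c
  rw [integral_finsetSum _ fun i _ => integrable_finsetSum _ fun j _ => hint _ _]
  simp only [integral_finsetSum _ fun j _ => hint _ _, integral_const_mul,
    integral_radial_monomial hβ]
  have h3 : ∀ i ∈ Finset.range (k + 1), ∑ j ∈ Finset.range (k + 1),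
      2 * Real.Gamma (k + 1) / Real.Gamma (k + β + 1) *
          (laguerreCoeff β k i * laguerreCoeff β k j) * (Real.Gamma ((j + i : ℕ) + β + 1) / 2) =
      if i = k then 1 else 0 := by
    intro i hi
    have h4 := sum_laguerreCoeff_mul_Gamma hβ (Nat.lt_succ_iff.mp (Finset.mem_range.mp hi))
    have h5 : ∑ j ∈ Finset.range (k + 1), 2 * Real.Gamma (k + 1) / Real.Gamma (k + β + 1) *
          (laguerreCoeff β k i * laguerreCoeff β k j) * (Real.Gamma ((j + i : ℕ) + β + 1) / 2) =
        Real.Gamma (k + 1) / Real.Gamma (k + β + 1) * laguerreCoeff β k i *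
          ∑ j ∈ Finset.range (k + 1), laguerreCoeff β k j * Real.Gamma ((j + i : ℕ) + β + 1) := by
      rw [Finset.mul_sum]
      exact Finset.sum_congr rfl fun j _ => by ring
    rw [h5, h4]
    split_ifs with h
    · rw [h, laguerreCoeff, div_self hG.ne', Real.Gamma_nat_eq_factorial, Nat.sub_self]
      have h6 : ((-1 : ℝ) ^ k) * (-1) ^ k = 1 := by rw [← mul_pow]; simp
      simp only [Nat.factorial_zero, Nat.cast_one, mul_one, one_mul]
      field_simp
      rw [sq, h6]
    · rw [mul_zero]
  rw [Finset.sum_congr rfl h3]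
  simp

end LaguerreIntegral

/-! ### Polar coordinates -/

section Polar

open MvPolynomial

variable {n : ℕ}

/-- No integrability is assumed: the changes of variables and the product formula hold for Bochner
integrals unconditionally. -/
theorem integral_polar (hn : 1 ≤ n) (a : ℝ → ℂ) (b : Rn n → ℂ) :
    ∫ x : Rn n, a ‖x‖ * b (‖x‖⁻¹ • x) =
      (∫ r in Set.Ioi (0 : ℝ), ((r ^ (n - 1) : ℝ) : ℂ) * a r) *
        ∫ x : Metric.sphere (0 : Rn n) 1, b x ∂(volume : Measure (Rn n)).toSphere := by
  have : Nontrivial (Rn n) := by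
    have : Nonempty (Fin n) := ⟨⟨0, hn⟩⟩
    infer_instance
  have hdim : Module.finrank ℝ (Rn n) = n := by simp
  calc ∫ x : Rn n, a ‖x‖ * b (‖x‖⁻¹ • x)
      = ∫ x : ({(0)}ᶜ : Set (Rn n)), a ‖x.1‖ * b (‖x.1‖⁻¹ • x.1) ∂(volume.comap Subtype.val) := by
        rw [integral_subtype_comap (measurableSet_singleton _).compl
          fun x : Rn n => a ‖x‖ * b (‖x‖⁻¹ • x), restrict_compl_singleton]
    _ = ∫ x : Metric.sphere (0 : Rn n) 1 × Set.Ioi (0 : ℝ), b x.1 * a x.2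
          ∂(volume : Measure (Rn n)).toSphere.prod (.volumeIoiPow (n - 1)) := by
        have h := (volume : Measure (Rn n)).measurePreserving_homeomorphUnitSphereProd.integral_comp
          (Homeomorph.measurableEmbedding _) (fun x => b x.1 * a x.2)
        rw [hdim] at h
        rw [← h]
        simp [mul_comm]
    _ = (∫ x : Metric.sphere (0 : Rn n) 1, b x ∂(volume : Measure (Rn n)).toSphere) *
          ∫ r : Set.Ioi (0 : ℝ), a r ∂.volumeIoiPow (n - 1) :=
        integral_prod_mul (fun x : Metric.sphere (0 : Rn n) 1 => b x)
          (fun r : Set.Ioi (0 : ℝ) => a r)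
    _ = _ := by
        rw [mul_comm]
        congr 1
        simp only [Measure.volumeIoiPow, ENNReal.ofReal]
        rw [integral_withDensity_eq_integral_smul,
          integral_subtype_comap measurableSet_Ioi fun r => Real.toNNReal (r ^ (n - 1)) • a r]
        · refine setIntegral_congr_fun measurableSet_Ioi fun r hr => ?_
          rw [NNReal.smul_def, Real.coe_toNNReal _ (pow_nonneg (le_of_lt hr) _), Complex.real_smul]
        · exact (measurable_subtype_coe.pow_const _).real_toNNReal

theorem evalAt_smul_of_isHomogeneous {p : MvPolynomial (Fin n) ℂ} {s : ℕ} (hp : p.IsHomogeneous s)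
    (r : ℝ) (x : Rn n) : evalAt p (r • x) = (r : ℂ) ^ s * evalAt p x := by
  simp only [evalAt, eval_eq, Finset.mul_sum]
  refine Finset.sum_congr rfl fun d hd => ?_
  have h : d.degree = s := by
    rw [Finsupp.degree_eq_weight_one]
    exact hp (mem_support_iff.mp hd)
  rw [← h, Finsupp.degree_apply, ← Finset.prod_pow_eq_pow_sum]
  simp only [PiLp.smul_apply, smul_eq_mul, Complex.ofReal_mul, mul_pow, Finset.prod_mul_distrib]
  ring

theorem integral_radial_mul_harmonic (hn : 1 ≤ n) {p q : MvPolynomial (Fin n) ℂ} {s t : ℕ}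
    (hp : p.IsHomogeneous s) (hq : q.IsHomogeneous t) (a : ℝ → ℂ) :
    ∫ x : Rn n, a ‖x‖ * (evalAt p x * star (evalAt q x)) =
      (∫ r in Set.Ioi (0 : ℝ), ((r ^ (n - 1) : ℝ) : ℂ) * (a r * (r : ℂ) ^ (s + t))) *
        sphereInner p q := by
  rw [sphereInner, ← integral_polar hn (fun r => a r * (r : ℂ) ^ (s + t))
    (fun x => evalAt p x * star (evalAt q x))]
  have : Nontrivial (Rn n) := by
    have : Nonempty (Fin n) := ⟨⟨0, hn⟩⟩
    infer_instance
  have h0 : ∀ᵐ x : Rn n, x ≠ 0 := by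
    simp [ae_iff]
  refine integral_congr_ae ?_
  filter_upwards [h0] with x hx
  have hx' : (‖x‖ : ℂ) ≠ 0 := by simpa using hx
  rw [evalAt_smul_of_isHomogeneous hp, evalAt_smul_of_isHomogeneous hq]
  rw [star_mul', star_pow, Complex.star_def, Complex.conj_ofReal, Complex.ofReal_inv, pow_add,
    inv_pow, inv_pow]
  field_simp

/-! ### Orthonormality of the system `φ_{k,s,j}` -/

/-- Both eigenvectors are combinations of Hermite polynomials of their own level, and Hermite
functions of different levels are orthogonal; symmetry of the oscillator is not invoked. -/
theorem inner_gaussL2_eq_zero_of_eigenspace {m l : ℕ} (hml : m ≠ l)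
    {p q : MvPolynomial (Fin n) ℂ} (hp : p ∈ (oscillatorPoly n).eigenspace (2 * m : ℂ))
    (hq : q ∈ (oscillatorPoly n).eigenspace (2 * l : ℂ)) :
    inner ℂ (gaussL2 n p) (gaussL2 n q) = 0 := by
  classical
  have h : ∀ (m : ℕ) {p : MvPolynomial (Fin n) ℂ},
      p ∈ (oscillatorPoly n).eigenspace (2 * m : ℂ) →
      gaussL2 n p ∈ Submodule.span ℂ (hermiteL2 '' {α : Fin n → ℕ | ∑ i, α i = m}) := by
    intro m p hp
    have h2 := Submodule.mem_map_of_mem (f := gaussL2 n)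
      (eigenspace_le_span_hermiteMv linearIndependent_hermiteMv m hp)
    rw [Submodule.map_span, Set.image_image] at h2
    simpa only [gaussL2_hermiteMv] using h2
  refine Submodule.isOrtho_iff_inner_eq.mp (Submodule.isOrtho_span.mpr ?_) _ (h m hp) _ (h l hq)
  rintro _ ⟨α, hα, rfl⟩ _ ⟨β, hβ, rfl⟩
  refine orthonormal_hermiteL2.2 fun hab => hml ?_
  subst hab
  exact hα.symm.trans hβ

/-- A solid harmonic of degree $s$ is itself an eigenvector of $T$ for $2s$, so different degrees
are orthogonal for the weight $e^{-|x|^2}$. In polar coordinates this product is the spherical one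
times a positive radial integral. -/
theorem sphereInner_eq_zero (hn : 1 ≤ n) {s t : ℕ} (hst : s ≠ t) {p q : MvPolynomial (Fin n) ℂ}
    (hp : p ∈ SolidHarmonic n s) (hq : q ∈ SolidHarmonic n t) : sphereInner p q = 0 := by
  have he : ∀ {s : ℕ} {p : MvPolynomial (Fin n) ℂ}, p ∈ SolidHarmonic n s →
      p ∈ (oscillatorPoly n).eigenspace (2 * s : ℂ) := by
    intro s p hp
    rw [Module.End.mem_eigenspace_iff, oscillatorPoly_of_isHomogeneous hp.1,
      LinearMap.mem_ker.mp hp.2, sub_zero]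
  have h1 := inner_gaussL2_eq_zero_of_eigenspace hst.symm (he hq) (he hp)
  have h2 := integral_radial_mul_harmonic hn hp.1 hq.1 (fun r => ((Real.exp (-r ^ 2) : ℝ) : ℂ))
  have h3 : ∫ x : Rn n, ((Real.exp (-‖x‖ ^ 2) : ℝ) : ℂ) * (evalAt p x * star (evalAt q x)) = 0 := by
    rw [← h1, inner_gaussL2_gaussL2]
    refine integral_congr_ae (Filter.Eventually.of_forall fun x => ?_)
    have h4 : Real.exp (-‖x‖ ^ 2) = Real.exp (-‖x‖ ^ 2 / 2) * Real.exp (-‖x‖ ^ 2 / 2) := by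
      rw [← Real.exp_add]
      congr 1
      ring
    simp only [gaussFun_apply, star_mul', Complex.star_def, Complex.conj_ofReal, h4]
    push_cast
    ring
  rw [h3] at h2
  refine (mul_eq_zero.mp h2.symm).resolve_left ?_
  have h5 := integral_rpow_mul_exp_neg_rpow (p := 2) (q := (n - 1 + (s + t) : ℕ)) (by norm_num)
    (by
      have : (0 : ℝ) ≤ (n - 1 + (s + t) : ℕ) := Nat.cast_nonneg _
      linarith)
  have h6 : ∫ r in Set.Ioi (0 : ℝ), ((r ^ (n - 1) : ℝ) : ℂ) *
      (((Real.exp (-r ^ 2) : ℝ) : ℂ) * (r : ℂ) ^ (s + t)) =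
      ((∫ r in Set.Ioi (0 : ℝ), r ^ ((n - 1 + (s + t) : ℕ) : ℝ) * Real.exp (-r ^ (2 : ℝ)) : ℝ) :
        ℂ) := by
    rw [← integral_complex_ofReal]
    refine integral_congr_ae (Filter.Eventually.of_forall fun r => ?_)
    simp only [Real.rpow_natCast, Real.rpow_two, pow_add]
    push_cast
    ring
  rw [h6, h5, ← Ne, Complex.ofReal_ne_zero]
  have := Real.Gamma_pos_of_pos (s := (((n - 1 + (s + t) : ℕ) : ℝ) + 1) / 2) (by positivity)
  positivity

theorem inner_phiL2_same_harmonic (hn : 1 ≤ n) {Y : HarmonicBases n} (hY : Y.IsOrthonormal)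
    (k s : ℕ) (i j : Fin (harmonicDim n s)) :
    inner ℂ (phiL2 Y k s i) (phiL2 Y k s j) = if i = j then 1 else 0 := by
  set β : ℝ := (n : ℝ) / 2 - 1 + s with hβdef
  have hn' : (1 : ℝ) ≤ n := by exact_mod_cast hn
  have hβ : -1 < β := by
    have : (0 : ℝ) ≤ s := Nat.cast_nonneg s
    rw [hβdef]; linarith
  have h1 := integral_radial_mul_harmonic hn (Y s j).2.1 (Y s i).2.1
    (fun r => ((laguerreFun β k r ^ 2 : ℝ) : ℂ))
  have h2 : ∫ r in Set.Ioi (0 : ℝ), ((r ^ (n - 1) : ℝ) : ℂ) *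
      (((laguerreFun β k r ^ 2 : ℝ) : ℂ) * (r : ℂ) ^ (s + s)) = 1 := by
    rw [← Complex.ofReal_one, ← integral_laguerreFun_sq hβ k, ← integral_complex_ofReal]
    refine setIntegral_congr_fun measurableSet_Ioi fun r hr => ?_
    -- The exponent is $2\beta+1=(n-1)+2s$: the polar Jacobian times the radial parts of the two
    -- harmonics.
    have e : r ^ (2 * β + 1) = r ^ (n - 1) * r ^ (s + s) := by
      rw [← pow_add, ← Real.rpow_natCast]
      congr 1
      rw [hβdef]
      push_cast [Nat.cast_sub hn]
      ring
    simp only [e]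
    push_cast
    ring
  rw [h2, one_mul, hY s j i] at h1
  rw [← gaussL2_laguerreMv, ← gaussL2_laguerreMv, inner_gaussL2_gaussL2, gaussFun_laguerreMv,
    gaussFun_laguerreMv]
  simp only [eq_comm (a := i)]
  rw [← h1]
  refine integral_congr_ae (Filter.Eventually.of_forall fun x => ?_)
  simp only [phiFun, star_mul', Complex.star_def, Complex.conj_ofReal]
  push_cast
  ring

theorem inner_phiL2_of_ne (hn : 1 ≤ n) (Y : HarmonicBases n) {k s l t : ℕ} (hst : s ≠ t)
    (i : Fin (harmonicDim n s)) (j : Fin (harmonicDim n t)) :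
    inner ℂ (phiL2 Y k s i) (phiL2 Y l t j) = 0 := by
  have h1 := integral_radial_mul_harmonic hn (Y t j).2.1 (Y s i).2.1
    (fun r => ((laguerreFun ((n : ℝ) / 2 - 1 + s) k r : ℝ) : ℂ) *
      ((laguerreFun ((n : ℝ) / 2 - 1 + t) l r : ℝ) : ℂ))
  rw [sphereInner_eq_zero hn hst.symm (Y t j).2 (Y s i).2, mul_zero] at h1
  rw [← gaussL2_laguerreMv, ← gaussL2_laguerreMv, inner_gaussL2_gaussL2, gaussFun_laguerreMv,
    gaussFun_laguerreMv, ← h1]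
  refine integral_congr_ae (Filter.Eventually.of_forall fun x => ?_)
  simp only [phiFun, star_mul', Complex.star_def, Complex.conj_ofReal]
  ring

/-- The polynomial `p` with `φ_{k,s,j} = p e^{-|x|²/2}`. -/
def phiMv (Y : HarmonicBases n) (t : PhiIndex n) : MvPolynomial (Fin n) ℂ :=
  laguerreMv t.1.1 t.1.2 (Y t.1.2 t.2 : MvPolynomial (Fin n) ℂ)

theorem gaussL2_phiMv (Y : HarmonicBases n) (t : PhiIndex n) :
    gaussL2 n (phiMv Y t) = phiSystem Y t := gaussL2_laguerreMv Y _ _ _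

theorem phiMv_mem_eigenspace (hn : 1 ≤ n) (Y : HarmonicBases n) (t : PhiIndex n) :
    phiMv Y t ∈ (oscillatorPoly n).eigenspace (2 * (t.1.2 + 2 * t.1.1 : ℕ) : ℂ) :=
  laguerreMv_mem_eigenspace hn (Y t.1.2 t.2).2 _

/-- Different $s$ are separated on the sphere, even when the eigenvalues coincide; equal $s$ with
different $k$ are separated by the eigenvalue $2(s+2k)$. -/
theorem orthonormal_phiSystem (hn : 1 ≤ n) {Y : HarmonicBases n} (hY : Y.IsOrthonormal) :
    Orthonormal ℂ (phiSystem Y) := by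
  classical
  rw [orthonormal_iff_ite]
  rintro ⟨⟨k, s⟩, i⟩ ⟨⟨l, t⟩, j⟩
  by_cases hst : s = t
  · subst hst
    by_cases hkl : k = l
    · subst hkl
      refine (inner_phiL2_same_harmonic hn hY k s i j).trans ?_
      simp
    · rw [← gaussL2_phiMv, ← gaussL2_phiMv, if_neg (by simp [hkl])]
      exact inner_gaussL2_eq_zero_of_eigenspace (by simp only; omega)
        (phiMv_mem_eigenspace hn Y ⟨(k, s), i⟩) (phiMv_mem_eigenspace hn Y ⟨(l, s), j⟩)
  · rw [if_neg (by simp [hst])]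
    exact inner_phiL2_of_ne hn Y hst i j

theorem linearIndependent_phiMv (hn : 1 ≤ n) {Y : HarmonicBases n} (hY : Y.IsOrthonormal) :
    LinearIndependent ℂ (phiMv Y) := by
  refine LinearIndependent.of_comp (gaussL2 n) ?_
  have h : gaussL2 n ∘ phiMv Y = phiSystem Y := funext (gaussL2_phiMv Y)
  rw [h]
  exact (orthonormal_phiSystem hn hY).linearIndependent

end Polar

/-! ### Completeness -/

section Completeness

variable {n : ℕ}

theorem integral_char_mul_withDensity (u : Rn n → ℝ) (hu : AEMeasurable u) (t : Rn n) :
    charFun ((volume : Measure (Rn n)).withDensity fun x => ENNReal.ofReal (u x)) t =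
      ∫ x : Rn n, Complex.exp (((inner ℝ x t : ℝ) : ℂ) * Complex.I) * ((max (u x) 0 : ℝ) : ℂ) := by
  have h := integral_withDensity_eq_integral_smul₀ (μ := (volume : Measure (Rn n)))
    (f := fun x => (u x).toNNReal) hu.real_toNNReal
    (fun x => Complex.exp (((inner ℝ x t : ℝ) : ℂ) * Complex.I))
  rw [charFun_apply]
  refine h.trans (integral_congr_ae (Filter.Eventually.of_forall fun x => ?_))
  simp only
  rw [NNReal.smul_def, Real.coe_toNNReal', Complex.real_smul, mul_comm]

theorem integrable_char_mul {F : Rn n → ℂ} (hF : Integrable F) (t : Rn n) :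
    Integrable fun x : Rn n => Complex.exp (((inner ℝ x t : ℝ) : ℂ) * Complex.I) * F x := by
  refine hF.bdd_mul (c := 1) (by fun_prop) (Filter.Eventually.of_forall fun x => ?_)
  rw [Complex.norm_exp_ofReal_mul_I]

/-- A real integrable function whose Fourier transform vanishes is zero. -/
theorem ae_eq_zero_of_integral_char_real {u : Rn n → ℝ} (hu : Integrable u)
    (h : ∀ t : Rn n,
      ∫ x : Rn n, Complex.exp (((inner ℝ x t : ℝ) : ℂ) * Complex.I) * ((u x : ℝ) : ℂ) = 0) :
    u =ᵐ[volume] 0 := by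
  have hp : Integrable fun x => ((max (u x) 0 : ℝ) : ℂ) := hu.pos_part.ofReal
  have hm : Integrable fun x => ((max (-u x) 0 : ℝ) : ℂ) := hu.neg_part.ofReal
  have hn : AEMeasurable (fun x => -u x) := hu.neg.aemeasurable
  -- The positive and negative parts of $u$ are densities of finite measures with equal
  -- characteristic functions, hence agree almost everywhere. As one of them is zero at each point,
  -- so is the other.
  have e : (volume : Measure (Rn n)).withDensity (fun x => ENNReal.ofReal (u x)) =
      (volume : Measure (Rn n)).withDensity (fun x => ENNReal.ofReal (-u x)) := by
    have : IsFiniteMeasure ((volume : Measure (Rn n)).withDensity fun x => ENNReal.ofReal (u x)) :=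
      isFiniteMeasure_withDensity_ofReal hu.2
    have : IsFiniteMeasure ((volume : Measure (Rn n)).withDensity fun x => ENNReal.ofReal (-u x)) :=
      isFiniteMeasure_withDensity_ofReal hu.neg.2
    refine Measure.ext_of_charFun (funext fun t => ?_)
    rw [integral_char_mul_withDensity u hu.aemeasurable,
      integral_char_mul_withDensity (fun x => -u x) hn, ← sub_eq_zero,
      ← integral_sub (integrable_char_mul hp t) (integrable_char_mul hm t), ← h t]
    refine integral_congr_ae (Filter.Eventually.of_forall fun x => ?_)
    simp only
    rw [← mul_sub, ← Complex.ofReal_sub]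
    congr 2
    rcases le_total (u x) 0 with h0 | h0
    · rw [max_eq_right h0, max_eq_left (by linarith)]; ring
    · rw [max_eq_left h0, max_eq_right (by linarith)]; ring
  rw [withDensity_eq_iff_of_sigmaFinite hu.aemeasurable.ennreal_ofReal
    hn.ennreal_ofReal] at e
  filter_upwards [e] with x hx
  rcases le_total (u x) 0 with h0 | h0
  · rw [ENNReal.ofReal_of_nonpos h0, eq_comm, ENNReal.ofReal_eq_zero] at hx
    simp only [Pi.zero_apply]
    linarith
  · rw [ENNReal.ofReal_of_nonpos (p := -u x) (by linarith), ENNReal.ofReal_eq_zero] at hx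
    simp only [Pi.zero_apply]
    linarith

/-- An integrable function whose Fourier transform vanishes is zero. -/
theorem ae_eq_zero_of_integral_char {F : Rn n → ℂ} (hF : Integrable F)
    (h : ∀ t : Rn n, ∫ x : Rn n, Complex.exp (((inner ℝ x t : ℝ) : ℂ) * Complex.I) * F x = 0) :
    F =ᵐ[volume] 0 := by
  -- Conjugation replaces $t$ by $-t$, so $\overline F$ also has vanishing transform, and therefore
  -- so do the real and imaginary parts.
  have h' : ∀ t : Rn n,
      ∫ x : Rn n, Complex.exp (((inner ℝ x t : ℝ) : ℂ) * Complex.I) * star (F x) = 0 := by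
    intro t
    have h1 := congrArg star (h (-t))
    rw [star_zero, Complex.star_def, ← integral_conj] at h1
    rw [← h1]
    refine integral_congr_ae (Filter.Eventually.of_forall fun x => ?_)
    simp only [map_mul, ← Complex.exp_conj, Complex.conj_ofReal, Complex.conj_I, inner_neg_right,
      Complex.star_def]
    push_cast
    congr 2
    ring
  have hs : Integrable fun x => star (F x) :=
    (LinearIsometryEquiv.integrable_comp_iff Complex.conjLIE).mpr hF
  have hre : (fun x => (F x).re) =ᵐ[volume] 0 := by
    refine ae_eq_zero_of_integral_char_real hF.re fun t => ?_
    have h1 : ∀ x : Rn n, Complex.exp (((inner ℝ x t : ℝ) : ℂ) * Complex.I) * (((F x).re : ℝ) : ℂ) =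
        (1 / 2) * (Complex.exp (((inner ℝ x t : ℝ) : ℂ) * Complex.I) * F x +
          Complex.exp (((inner ℝ x t : ℝ) : ℂ) * Complex.I) * star (F x)) := by
      intro x
      rw [Complex.re_eq_add_conj, Complex.star_def]
      ring
    simp only [h1]
    rw [integral_const_mul, integral_add (integrable_char_mul hF t) (integrable_char_mul hs t),
      h, h', add_zero, mul_zero]
  have him : (fun x => (F x).im) =ᵐ[volume] 0 := by
    refine ae_eq_zero_of_integral_char_real hF.im fun t => ?_
    have h1 : ∀ x : Rn n, Complex.exp (((inner ℝ x t : ℝ) : ℂ) * Complex.I) * (((F x).im : ℝ) : ℂ) =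
        (1 / (2 * Complex.I)) * (Complex.exp (((inner ℝ x t : ℝ) : ℂ) * Complex.I) * F x -
          Complex.exp (((inner ℝ x t : ℝ) : ℂ) * Complex.I) * star (F x)) := by
      intro x
      rw [Complex.im_eq_sub_conj, Complex.star_def]
      ring
    simp only [h1]
    rw [integral_const_mul, integral_sub (integrable_char_mul hF t) (integrable_char_mul hs t),
      h, h', sub_zero, mul_zero]
  filter_upwards [hre, him] with x h1 h2
  exact Complex.ext h1 h2

/-! ### Totality of polynomials times the Gaussian -/

theorem memLp_exp_norm_mul_gaussian (c : ℝ) :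
    MemLp (fun x : Rn n => Real.exp (c * ‖x‖) * Real.exp (-‖x‖ ^ 2 / 2)) 2 volume := by
  have hg : MemLp (fun x : Rn n => Real.exp (-‖x‖ ^ 2 / 4)) 2 volume := by
    rw [memLp_two_iff_integrable_sq (by fun_prop)]
    have h2 := (GaussianFourier.integrable_cexp_neg_mul_sq_norm_add (V := Rn n)
      (b := (1 / 2 : ℂ)) (by norm_num) 0 0).norm
    refine h2.congr (Filter.Eventually.of_forall fun x => ?_)
    simp only [Complex.norm_exp, ← Real.exp_nat_mul]
    congr 1
    have : (-(1 / 2 : ℂ) * (‖x‖ : ℂ) ^ 2 + 0 * ((inner ℝ (0 : Rn n) x : ℝ) : ℂ)) =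
        ((-(1 / 2) * ‖x‖ ^ 2 : ℝ) : ℂ) := by push_cast; ring
    rw [this, Complex.ofReal_re]
    push_cast
    ring
  refine (hg.const_mul (Real.exp (c ^ 2))).of_le (by fun_prop)
    (Filter.Eventually.of_forall fun x => ?_)
  rw [Real.norm_of_nonneg (by positivity), Real.norm_of_nonneg (by positivity), ← Real.exp_add,
    ← Real.exp_add]
  exact Real.exp_le_exp.mpr (by nlinarith [sq_nonneg (‖x‖ / 2 - c)])

/-- With $F=e^{-|x|^2/2}f$, orthogonality to the powers $(t\cdot x)^k$ kills every term of the
exponential series of $e^{i t\cdot x}$ integrated against $F$. Thus the Fourier transform of $F$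
vanishes, and $f=0$. -/
theorem eq_zero_of_inner_gaussL2 (f : L2 n)
    (h : ∀ p : MvPolynomial (Fin n) ℂ, inner ℂ (gaussL2 n p) f = 0) : f = 0 := by
  set F : Rn n → ℂ := fun x => ((Real.exp (-‖x‖ ^ 2 / 2) : ℝ) : ℂ) * f x
  have hfm : MemLp (f : Rn n → ℂ) 2 volume := Lp.memLp f
  have hdom : ∀ c : ℝ, Integrable fun x : Rn n => Real.exp (c * ‖x‖) * ‖F x‖ := by
    intro c
    have h1 := (memLp_exp_norm_mul_gaussian (n := n) c).integrable_mul hfm.norm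
    refine h1.congr (Filter.Eventually.of_forall fun x => ?_)
    simp only [F, Pi.mul_apply, norm_mul, Complex.norm_real, Real.norm_of_nonneg (Real.exp_pos _).le]
    ring
  have hFm : AEStronglyMeasurable F volume := by
    refine AEStronglyMeasurable.mul ?_ hfm.1
    exact Continuous.aestronglyMeasurable (by fun_prop)
  have hF : Integrable F := by
    have h1 := hdom 0
    simp only [zero_mul, Real.exp_zero, one_mul] at h1
    exact (integrable_norm_iff hFm).mp h1
  have hmom : ∀ (t : Rn n) (k : ℕ), ∫ x : Rn n, ((inner ℝ x t : ℝ) : ℂ) ^ k * F x = 0 := by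
    intro t k
    rw [← h ((∑ i, MvPolynomial.C ((t i : ℝ) : ℂ) * MvPolynomial.X i) ^ k), inner_gaussL2]
    refine integral_congr_ae (Filter.Eventually.of_forall fun x => ?_)
    have h1 : evalAt ((∑ i, MvPolynomial.C ((t i : ℝ) : ℂ) * MvPolynomial.X i) ^ k) x =
        (((inner ℝ x t : ℝ) ^ k : ℝ) : ℂ) := by
      simp [evalAt, PiLp.inner_apply]
    simp only [gaussFun_apply, h1, star_mul', Complex.star_def, Complex.conj_ofReal, F]
    push_cast
    ring
  have hchar : ∀ t : Rn n,
      ∫ x : Rn n, Complex.exp (((inner ℝ x t : ℝ) : ℂ) * Complex.I) * F x = 0 := by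
    intro t
    -- The bounds sum to $e^{\|t\|\|x\|}|F(x)|$, which is integrable because the Gaussian absorbs
    -- the exponential; this allows integration term by term.
    have hs := hasSum_integral_of_dominated_convergence (μ := (volume : Measure (Rn n)))
      (F := fun (k : ℕ) (x : Rn n) =>
        ((((inner ℝ x t : ℝ) : ℂ) * Complex.I) ^ k / (k.factorial : ℂ)) * F x)
      (f := fun x => Complex.exp (((inner ℝ x t : ℝ) : ℂ) * Complex.I) * F x)
      (fun k x => ((‖t‖ * ‖x‖) ^ k / k.factorial) * ‖F x‖)
      (fun k => AEStronglyMeasurable.mul (Continuous.aestronglyMeasurable (by fun_prop)) hFm)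
      (fun k => Filter.Eventually.of_forall fun x => by
        rw [norm_mul, norm_div, norm_pow, norm_mul, Complex.norm_I, mul_one, Complex.norm_real,
          Complex.norm_natCast]
        have := (norm_inner_le_norm (𝕜 := ℝ) x t).trans_eq (mul_comm _ _)
        gcongr)
      (Filter.Eventually.of_forall fun x => (Real.summable_pow_div_factorial _).mul_right _)
      (by
        refine (hdom ‖t‖).congr (Filter.Eventually.of_forall fun x => ?_)
        simp only
        rw [tsum_mul_right, Real.exp_eq_exp_ℝ, NormedSpace.exp_eq_tsum_div])
      (Filter.Eventually.of_forall fun x => by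
        refine HasSum.mul_right _ ?_
        rw [Complex.exp_eq_exp_ℂ]
        exact NormedSpace.expSeries_div_hasSum_exp _)
    refine hs.unique ?_
    convert hasSum_zero with k
    have h2 : ∀ x : Rn n, ((((inner ℝ x t : ℝ) : ℂ) * Complex.I) ^ k / (k.factorial : ℂ)) * F x =
        (Complex.I ^ k / (k.factorial : ℂ)) * (((inner ℝ x t : ℝ) : ℂ) ^ k * F x) := by
      intro x
      rw [mul_pow]
      ring
    simp only [h2]
    rw [integral_const_mul, hmom, mul_zero]
  have h0 := ae_eq_zero_of_integral_char hF hchar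
  rw [Lp.eq_zero_iff_ae_eq_zero]
  filter_upwards [h0] with x hx
  exact (mul_eq_zero.mp hx).resolve_left (Complex.ofReal_ne_zero.mpr (Real.exp_pos _).ne')

end Completeness

/-! ### Extension of the harmonic oscillator -/

section Extension

open MvPolynomial

variable {n : ℕ}

theorem hasLineDerivAt_evalAt (p : MvPolynomial (Fin n) ℂ) (x : Rn n) (i : Fin n) :
    HasLineDerivAt ℝ (fun y : Rn n => evalAt p y) (evalAt (pderiv i p) x) x
      (EuclideanSpace.single i 1) := by
  rw [HasLineDerivAt]
  induction p using MvPolynomial.induction_on with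
  | C a =>
    simp only [evalAt, eval_C, pderiv_C, map_zero]
    exact hasDerivAt_const _ _
  | add p q hp hq =>
    refine (hp.add hq).congr_deriv ?_ |>.congr_of_eventuallyEq
      (Filter.Eventually.of_forall fun t => ?_)
    · simp [evalAt]
    · simp [evalAt]
  | mul_X p j hp =>
    have hX : HasDerivAt (fun t : ℝ => (((x + t • EuclideanSpace.single i (1 : ℝ)) j : ℝ) : ℂ))
        (evalAt (pderiv i (X j)) x) 0 := by
      have h1 : HasDerivAt (fun t : ℝ => x j + t * (EuclideanSpace.single i (1 : ℝ)) j)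
          ((EuclideanSpace.single i (1 : ℝ)) j) 0 := by
        refine (((hasDerivAt_id (0 : ℝ)).mul_const _).const_add _).congr_deriv ?_
        rw [one_mul]
      refine h1.ofReal_comp.congr_deriv ?_
      by_cases hij : j = i
      · subst hij
        simp [evalAt]
      · simp [evalAt, pderiv_X_of_ne hij, hij]
    refine (hp.mul hX).congr_deriv ?_ |>.congr_of_eventuallyEq
      (Filter.Eventually.of_forall fun t => ?_)
    · simp [evalAt]
      ring
    · simp [evalAt]

/-- The polynomial `∂ᵢ p - xᵢ p`, so that `∂ᵢ (p e^{-|x|²/2}) = (∂ᵢ p - xᵢ p) e^{-|x|²/2}`. -/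
def gaussDeriv (i : Fin n) (p : MvPolynomial (Fin n) ℂ) : MvPolynomial (Fin n) ℂ :=
  pderiv i p - X i * p

theorem hasLineDerivAt_gaussFun (p : MvPolynomial (Fin n) ℂ) (x : Rn n) (i : Fin n) :
    HasLineDerivAt ℝ (gaussFun n p) (gaussFun n (gaussDeriv i p) x) x
      (EuclideanSpace.single i 1) := by
  have e : gaussFun n p = fun y => evalAt p y * Complex.exp (-(evalAt (normSqMv n) y) / 2) := by
    funext y
    rw [gaussFun_apply, evalAt_normSqMv]
    push_cast
    rfl
  have h1 := hasLineDerivAt_evalAt p x i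
  have h2 := hasLineDerivAt_evalAt (normSqMv n) x i
  rw [HasLineDerivAt] at h1 h2 ⊢
  rw [e]
  refine (h1.mul (h2.neg.div_const 2).cexp).congr_deriv ?_
  rw [pderiv_normSqMv, gaussFun_apply]
  simp only [zero_smul, add_zero, evalAt_normSqMv]
  simp [evalAt, gaussDeriv]
  ring

/-- The algebraic form of the conjugation: it expresses $\Delta(pe^{-|x|^2/2})$ through $T$, which
makes $-\Delta+|x|^2$ act as $T+n$. -/
theorem sum_gaussDeriv_gaussDeriv (p : MvPolynomial (Fin n) ℂ) :
    ∑ i, gaussDeriv i (gaussDeriv i p) =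
      normSqMv n * p - (oscillatorPoly n p + (n : ℂ) • p) := by
  have h : ∀ i, gaussDeriv i (gaussDeriv i p) =
      X i ^ 2 * p - ((2 * (X i * pderiv i p) - pderiv i (pderiv i p)) + p) := by
    intro i
    simp only [gaussDeriv, map_sub, pderiv_mul, pderiv_X_self, one_mul]
    ring
  simp only [h, Finset.sum_sub_distrib, Finset.sum_add_distrib, oscillatorPoly_apply, normSqMv,
    Finset.sum_mul]
  rw [Finset.sum_const, Finset.card_univ, Fintype.card_fin, ← Nat.cast_smul_eq_nsmul ℂ]

theorem integral_gaussFun_mul_lineDeriv (p : MvPolynomial (Fin n) ℂ) (i : Fin n)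
    {g g' : Rn n → ℂ} (hg : Continuous g) (hg' : Continuous g') (hc : HasCompactSupport g)
    (hc' : HasCompactSupport g')
    (hd : ∀ x, HasLineDerivAt ℝ g (g' x) x (EuclideanSpace.single i 1)) :
    ∫ x, gaussFun n p x * g' x = -∫ x, gaussFun n (gaussDeriv i p) x * g x :=
  integral_bilinear_hasLineDerivAt_right_eq_neg_left_of_integrable
    (B := ContinuousLinearMap.mul ℝ ℂ)
    (((continuous_gaussFun _).mul hg).integrable_of_hasCompactSupport hc.mul_left)
    (((continuous_gaussFun _).mul hg').integrable_of_hasCompactSupport hc'.mul_left)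
    (((continuous_gaussFun _).mul hg).integrable_of_hasCompactSupport hc.mul_left)
    (fun x _ => hasLineDerivAt_gaussFun p x i) (fun x _ => hd x)

/-! ### The oscillator on test functions, in weak form -/

variable {f : Rn n → ℂ}

theorem continuous_fderiv_fderiv_apply (hf : ContDiff ℝ ∞ f) (v : Rn n) :
    Continuous fun x => fderiv ℝ (fderiv ℝ f) x v v := by
  have h1 : ContDiff ℝ ∞ (fderiv ℝ f) := hf.fderiv_right (by simp)
  exact ((h1.continuous_fderiv (by simp)).clm_apply continuous_const).clm_apply continuous_const

theorem laplacian_eq_sum (f : Rn n → ℂ) (x : Rn n) :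
    Laplacian.laplacian f x = ∑ i, fderiv ℝ (fderiv ℝ f) x (EuclideanSpace.single i 1)
      (EuclideanSpace.single i 1) := by
  rw [InnerProductSpace.laplacian_eq_iteratedFDeriv_orthonormalBasis f
    (EuclideanSpace.basisFun (Fin n) ℝ)]
  simp [iteratedFDeriv_two_apply]

theorem hasCompactSupport_fderiv_fderiv_apply (hc : HasCompactSupport f) (v : Rn n) :
    HasCompactSupport fun x => fderiv ℝ (fderiv ℝ f) x v v :=
  ((hc.fderiv ℝ).fderiv ℝ).comp_left (g := fun L : Rn n →L[ℝ] Rn n →L[ℝ] ℂ => L v v) rfl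

theorem integral_gaussFun_mul_fderiv_fderiv (hf : ContDiff ℝ ∞ f) (hc : HasCompactSupport f)
    (p : MvPolynomial (Fin n) ℂ) (i : Fin n) :
    ∫ x, gaussFun n p x *
        fderiv ℝ (fderiv ℝ f) x (EuclideanSpace.single i 1) (EuclideanSpace.single i 1) =
      ∫ x, gaussFun n (gaussDeriv i (gaussDeriv i p)) x * f x := by
  set v : Rn n := EuclideanSpace.single i 1
  have h1 : ContDiff ℝ ∞ (fderiv ℝ f) := hf.fderiv_right (by simp)
  have hgc : Continuous fun x => fderiv ℝ f x v := h1.continuous.clm_apply continuous_const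
  have hgs : HasCompactSupport fun x => fderiv ℝ f x v :=
    (hc.fderiv ℝ).comp_left (g := fun L : Rn n →L[ℝ] ℂ => L v) rfl
  rw [integral_gaussFun_mul_lineDeriv p i hgc (continuous_fderiv_fderiv_apply hf v) hgs
    (hasCompactSupport_fderiv_fderiv_apply hc v) fun x => ?_,
    integral_gaussFun_mul_lineDeriv (gaussDeriv i p) i hf.continuous hgc hc hgs fun x => ?_,
    neg_neg]
  · exact ((hf.differentiable (by simp)) x).hasFDerivAt.hasLineDerivAt v
  · have h2 := ((h1.differentiable (by simp)) x).hasFDerivAt.clm_apply (hasFDerivAt_const v x)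
    have h3 := h2.hasLineDerivAt v
    simpa using h3

theorem integral_gaussFun_mul_oscillator (hf : ContDiff ℝ ∞ f) (hc : HasCompactSupport f)
    (p : MvPolynomial (Fin n) ℂ) :
    ∫ x, gaussFun n p x * (-(Laplacian.laplacian f x) + ((‖x‖ ^ 2 : ℝ) : ℂ) * f x) =
      ∫ x, gaussFun n (oscillatorPoly n p + (n : ℂ) • p) x * f x := by
  have hi : ∀ q, Integrable fun x => gaussFun n q x * f x := fun q =>
    ((continuous_gaussFun _).mul hf.continuous).integrable_of_hasCompactSupport hc.mul_left
  have hi2 : ∀ i : Fin n, Integrable fun x => gaussFun n p x *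
      fderiv ℝ (fderiv ℝ f) x (EuclideanSpace.single i 1) (EuclideanSpace.single i 1) := fun i =>
    ((continuous_gaussFun _).mul
      (continuous_fderiv_fderiv_apply hf _)).integrable_of_hasCompactSupport
      (hasCompactSupport_fderiv_fderiv_apply hc _).mul_left
  have e1 : ∀ x, gaussFun n p x * (-(Laplacian.laplacian f x) + ((‖x‖ ^ 2 : ℝ) : ℂ) * f x) =
      gaussFun n (normSqMv n * p) x * f x - ∑ i, gaussFun n p x *
        fderiv ℝ (fderiv ℝ f) x (EuclideanSpace.single i 1) (EuclideanSpace.single i 1) := by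
    intro x
    have h : gaussFun n (normSqMv n * p) x = ((‖x‖ ^ 2 : ℝ) : ℂ) * gaussFun n p x := by
      rw [gaussFun_apply, gaussFun_apply, ← evalAt_normSqMv]
      simp [evalAt, mul_assoc]
    rw [laplacian_eq_sum, h, ← Finset.mul_sum]
    ring
  simp only [e1]
  rw [integral_sub (hi _) (integrable_finsetSum _ fun i _ => hi2 i),
    integral_finsetSum _ fun i _ => hi2 i]
  simp only [integral_gaussFun_mul_fderiv_fderiv hf hc]
  rw [← integral_finsetSum _ fun i _ => hi _, ← integral_sub (hi _)
    (integrable_finsetSum _ fun i _ => hi _)]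
  refine integral_congr_ae (Filter.Eventually.of_forall fun x => ?_)
  have h := congrArg (fun q => gaussFun n q x) (sum_gaussDeriv_gaussDeriv p)
  simp only [map_sum, map_sub, Finset.sum_apply, Pi.sub_apply] at h
  simp only
  rw [← Finset.sum_mul, h]
  ring

theorem hermiteFun_star (α : Fin n → ℕ) (x : Rn n) : star (hermiteFun α x) = hermiteFun α x :=
  Complex.conj_ofReal _

/-- Both derivatives are moved from the test function onto $h_\alpha$, so the coefficients of
$(-\Delta+|x|^2)f$ are $n+2|\alpha|$ times those of $f$. The weak criterion then yields the domain
and the value at once. -/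
theorem extendsHarmonicOscillator_hermiteOperator
    (b : HilbertBasis (Fin n → ℕ) ℂ (L2 n)) (hb : ⇑b = hermiteL2) :
    ExtendsHarmonicOscillator (hermiteOperator n) := by
  intro f hf hc
  have hL : Continuous fun x => -(Laplacian.laplacian f x) + ((‖x‖ ^ 2 : ℝ) : ℂ) * f x := by
    simp only [laplacian_eq_sum]
    exact (continuous_finsetSum _ fun i _ => continuous_fderiv_fderiv_apply hf _).neg.add
      ((by fun_prop : Continuous fun x : Rn n => ((‖x‖ ^ 2 : ℝ) : ℂ)).mul hf.continuous)
  have hLc : HasCompactSupport fun x =>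
      -(Laplacian.laplacian f x) + ((‖x‖ ^ 2 : ℝ) : ℂ) * f x := by
    refine HasCompactSupport.add ?_ hc.mul_left
    simp only [laplacian_eq_sum]
    refine HasCompactSupport.comp_left (g := fun L : Rn n →L[ℝ] Rn n →L[ℝ] ℂ =>
      -∑ i, L (EuclideanSpace.single i 1) (EuclideanSpace.single i 1)) ((hc.fderiv ℝ).fderiv ℝ) ?_
    simp
  have hf2 : MemLp f 2 volume := hf.continuous.memLp_of_hasCompactSupport hc
  have hL2 := hL.memLp_of_hasCompactSupport (p := 2) (μ := volume) hLc
  have key : ∀ α, inner ℂ (b α) (hL2.toLp _) =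
      (((n : ℝ) + 2 * ((∑ i, α i : ℕ) : ℝ) : ℝ) : ℂ) * inner ℂ (b α) (hf2.toLp f) := by
    intro α
    rw [hb, ← gaussL2_hermiteMv, inner_gaussL2, inner_gaussL2]
    have e1 : ∫ x, star (gaussFun n (hermiteMv α) x) * hL2.toLp _ x = ∫ x,
        gaussFun n (hermiteMv α) x *
          (-(Laplacian.laplacian f x) + ((‖x‖ ^ 2 : ℝ) : ℂ) * f x) := by
      refine integral_congr_ae ?_
      filter_upwards [hL2.coeFn_toLp] with x hx
      rw [hx, gaussFun_hermiteMv, hermiteFun_star]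
    have e2 : ∫ x, star (gaussFun n (hermiteMv α) x) * hf2.toLp _ x = ∫ x,
        gaussFun n (hermiteMv α) x * f x := by
      refine integral_congr_ae ?_
      filter_upwards [hf2.coeFn_toLp] with x hx
      rw [hx, gaussFun_hermiteMv, hermiteFun_star]
    rw [e1, e2, integral_gaussFun_mul_oscillator hf hc, oscillatorPoly_hermiteMv, ← add_smul,
      ← integral_const_mul]
    refine integral_congr_ae (Filter.Eventually.of_forall fun x => ?_)
    simp only [map_smul, Pi.smul_apply, smul_eq_mul]
    push_cast
    ring
  rw [hermiteOperator, ← hb]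
  refine ⟨⟨hf2.toLp f, mem_domain_of_inner_eq b _ key⟩, hf2.coeFn_toLp, ?_⟩
  rw [diagonalOperator_eq_of_inner_eq b _ key]
  exact hL2.coeFn_toLp

end Extension

/-! ### Comparison of the two systems -/

section Comparison

variable {n : ℕ}

theorem hermiteMv_mem_eigenspace (α : Fin n → ℕ) :
    hermiteMv α ∈ (oscillatorPoly n).eigenspace (2 * (∑ i, α i : ℕ) : ℂ) := by
  rw [Module.End.mem_eigenspace_iff, oscillatorPoly_hermiteMv]

theorem span_hermiteMv_eq_eigenspace (m : ℕ) :
    Submodule.span ℂ (hermiteMv '' {α : Fin n → ℕ | ∑ i, α i = m}) =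
      (oscillatorPoly n).eigenspace (2 * m : ℂ) := by
  refine le_antisymm (Submodule.span_le.mpr ?_)
    (eigenspace_le_span_hermiteMv linearIndependent_hermiteMv m)
  rintro _ ⟨α, hα, rfl⟩
  have hα' : ∑ i, α i = m := hα
  exact hα' ▸ hermiteMv_mem_eigenspace α

/-- The triples `(k, m - 2k, j)`. -/
abbrev PhiLevel (n m : ℕ) : Type := Σ k : Fin (m / 2 + 1), Fin (harmonicDim n (m - 2 * k))

/-- The inclusion of the triples `(k, m - 2k, j)` into all triples `(k, s, j)`. -/
def PhiLevel.toIndex {m : ℕ} (t : PhiLevel n m) : PhiIndex n := ⟨(t.1, m - 2 * t.1), t.2⟩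

theorem PhiLevel.toIndex_injective {m : ℕ} :
    Function.Injective (PhiLevel.toIndex (n := n) (m := m)) := by
  rintro ⟨⟨k, hk⟩, i⟩ ⟨⟨l, hl⟩, j⟩ h
  obtain rfl : k = l := congrArg (fun t : PhiIndex n => t.1.1) h
  obtain rfl : i = j := eq_of_heq (Sigma.mk.inj h).2
  rfl

theorem PhiLevel.level_toIndex {m : ℕ} (t : PhiLevel n m) :
    t.toIndex.1.2 + 2 * t.toIndex.1.1 = m := by
  have := t.1.2
  simp only [PhiLevel.toIndex]
  omega

/-- The polar polynomials of level $m$ are independent members of an eigenspace whose dimension is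
at most the number of multi-indices of length $m$, hence at most their own number. -/
theorem span_phiMv_eq_eigenspace (hn : 1 ≤ n) {Y : HarmonicBases n} (hY : Y.IsOrthonormal)
    (m : ℕ) :
    Submodule.span ℂ (Set.range fun t : PhiLevel n m => phiMv Y t.toIndex) =
      (oscillatorPoly n).eigenspace (2 * m : ℂ) := by
  classical
  have hset : hermiteMv '' {α : Fin n → ℕ | ∑ i, α i = m} =
      ((Finset.piAntidiag (Finset.univ : Finset (Fin n)) m).image hermiteMv : Set _) := by
    rw [Finset.coe_image]
    congr 1
    ext α
    simp [Finset.mem_piAntidiag]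
  have hspan := span_hermiteMv_eq_eigenspace (n := n) m
  rw [hset] at hspan
  have : FiniteDimensional ℂ ((oscillatorPoly n).eigenspace (2 * m : ℂ)) := by
    rw [← hspan]
    infer_instance
  refine span_range_eq_of_finrank_le_card
    ((linearIndependent_phiMv hn hY).comp _ PhiLevel.toIndex_injective) _ (fun t => ?_) ?_
  · have h := phiMv_mem_eigenspace hn Y t.toIndex
    rwa [t.level_toIndex] at h
  · rw [← hspan]
    refine (finrank_span_finset_le_card _).trans (Finset.card_image_le.trans ?_)
    refine (card_piAntidiag_le_sum_harmonicDim n m).trans (le_of_eq ?_)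
    rw [Fintype.card_sigma, Finset.sum_range]
    simp

theorem span_phiMv_eq_top (hn : 1 ≤ n) {Y : HarmonicBases n} (hY : Y.IsOrthonormal) :
    Submodule.span ℂ (Set.range (phiMv Y)) = ⊤ := by
  rw [eq_top_iff, ← span_hermiteMv_eq_top linearIndependent_hermiteMv, Submodule.span_le]
  rintro _ ⟨α, rfl⟩
  have h := hermiteMv_mem_eigenspace α
  rw [← span_phiMv_eq_eigenspace hn hY] at h
  exact Submodule.span_mono (Set.range_comp_subset_range PhiLevel.toIndex (phiMv Y)) h

theorem exists_hilbertBasis_of_span_eq_top {ι : Type*} {v : ι → MvPolynomial (Fin n) ℂ}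
    {e : ι → L2 n} (he : Orthonormal ℂ e) (hev : ∀ i, gaussL2 n (v i) = e i)
    (hv : Submodule.span ℂ (Set.range v) = ⊤) : ∃ b : HilbertBasis ι ℂ (L2 n), ⇑b = e := by
  refine ⟨HilbertBasis.mkOfOrthogonalEqBot he ?_, HilbertBasis.coe_mkOfOrthogonalEqBot he _⟩
  rw [eq_bot_iff]
  intro f hf
  rw [Submodule.mem_bot]
  refine eq_zero_of_inner_gaussL2 f fun p => ?_
  refine (Submodule.mem_orthogonal _ _).mp hf _ ?_
  have h := Submodule.mem_map_of_mem (f := gaussL2 n) (hv.ge (Submodule.mem_top (x := p)))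
  rw [Submodule.map_span, ← Set.range_comp] at h
  rwa [show gaussL2 n ∘ v = e from funext hev] at h

theorem inner_hermiteL2_phiSystem (hn : 1 ≤ n) (Y : HarmonicBases n) (α : Fin n → ℕ)
    (t : PhiIndex n) (h : ∑ i, α i ≠ t.1.2 + 2 * t.1.1) :
    inner ℂ (hermiteL2 α) (phiSystem Y t) = 0 := by
  rw [← gaussL2_hermiteMv, ← gaussL2_phiMv]
  exact inner_gaussL2_eq_zero_of_eigenspace h (hermiteMv_mem_eigenspace α)
    (phiMv_mem_eigenspace hn Y t)

/-! ### Independence of the reproducing sum from the orthonormal basis -/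

section ChangeOfBasis

variable {ι κ P E : Type*} [Fintype ι] [Fintype κ] [AddCommGroup P] [Module ℂ P]
  [NormedAddCommGroup E] [InnerProductSpace ℂ E]

theorem eq_sum_inner_smul_of_mem_span (G : P →ₗ[ℂ] E) {v : κ → P}
    (hv : Orthonormal ℂ fun j => G (v j)) {u : P} (hu : u ∈ Submodule.span ℂ (Set.range v)) :
    u = ∑ j, inner ℂ (G (v j)) (G u) • v j := by
  obtain ⟨c, rfl⟩ := (Submodule.mem_span_range_iff_exists_fun ℂ).mp hu
  refine Finset.sum_congr rfl fun j _ => ?_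
  rw [map_sum]
  simp only [map_smul]
  rw [hv.inner_right_fintype]

/-- The sum `∑ᵢ conj (ℓ uᵢ) uᵢ` over an orthonormal basis of a finite-dimensional space does not
depend on the basis. -/
theorem sum_star_smul_eq (G : P →ₗ[ℂ] E) {u : ι → P} {v : κ → P}
    (hu : Orthonormal ℂ fun i => G (u i)) (hv : Orthonormal ℂ fun j => G (v j))
    (huv : Submodule.span ℂ (Set.range u) = Submodule.span ℂ (Set.range v)) (l : P →ₗ[ℂ] ℂ) :
    ∑ i, star (l (u i)) • u i = ∑ j, star (l (v j)) • v j := by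
  have h1 : ∀ i, u i = ∑ j, inner ℂ (G (v j)) (G (u i)) • v j := fun i =>
    eq_sum_inner_smul_of_mem_span G hv (huv ▸ Submodule.subset_span ⟨i, rfl⟩)
  have h2 : ∀ j, v j = ∑ i, inner ℂ (G (u i)) (G (v j)) • u i := fun j =>
    eq_sum_inner_smul_of_mem_span G hu (huv ▸ Submodule.subset_span ⟨j, rfl⟩)
  have h3 : ∀ j, star (l (v j)) = ∑ i, star (l (u i)) * inner ℂ (G (v j)) (G (u i)) := by
    intro j
    conv_lhs => rw [h2 j]
    simp only [map_sum, map_smul, star_sum, smul_eq_mul, star_mul', Complex.star_def,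
      inner_conj_symm, mul_comm]
  simp only [h3, Finset.sum_smul, mul_smul]
  -- After exchanging the sums, the inner one is the expansion of `u i` along `v`.
  rw [Finset.sum_comm]
  refine Finset.sum_congr rfl fun i _ => ?_
  rw [← Finset.smul_sum, ← h1 i]

end ChangeOfBasis

/-- One identity with a free functional $l$ serves twice: $l$ the pairing with a fixed $f\in L^2$
gives the spectral projections, and $l$ the evaluation at $y$ gives the kernels pointwise rather
than almost everywhere. -/
theorem sum_star_smul_hermiteMv_eq (hn : 1 ≤ n) {Y : HarmonicBases n} (hY : Y.IsOrthonormal)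
    (m : ℕ) (l : MvPolynomial (Fin n) ℂ →ₗ[ℂ] ℂ) :
    ∑ α ∈ Finset.piAntidiag (Finset.univ : Finset (Fin n)) m,
        star (l (hermiteMv α)) • hermiteMv α =
      ∑ k ∈ Finset.range (m / 2 + 1), ∑ j : Fin (harmonicDim n (m - 2 * k)),
        star (l (phiMv Y ⟨(k, m - 2 * k), j⟩)) • phiMv Y ⟨(k, m - 2 * k), j⟩ := by
  have h := sum_star_smul_eq (gaussL2 n)
    (u := fun α : Finset.piAntidiag (Finset.univ : Finset (Fin n)) m => hermiteMv (α : Fin n → ℕ))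
    (v := fun t : PhiLevel n m => phiMv Y t.toIndex)
    (by
      simp only [gaussL2_hermiteMv]
      exact orthonormal_hermiteL2.comp _ Subtype.coe_injective)
    (by
      simp only [gaussL2_phiMv]
      exact (orthonormal_phiSystem hn hY).comp _ PhiLevel.toIndex_injective)
    (by
      rw [span_phiMv_eq_eigenspace hn hY, ← span_hermiteMv_eq_eigenspace]
      congr 1
      ext p
      simp [Finset.mem_piAntidiag])
    l
  rw [Finset.sum_coe_sort (Finset.piAntidiag (Finset.univ : Finset (Fin n)) m)
    fun α => star (l (hermiteMv α)) • hermiteMv α] at h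
  rw [h, Fintype.sum_sigma, Finset.sum_range]
  rfl

theorem hermiteProjection_eq_polarProjection (hn : 1 ≤ n) {Y : HarmonicBases n}
    (hY : Y.IsOrthonormal) (m : ℕ) : hermiteProjection n m = polarProjection Y m := by
  ext1 f
  have h := congrArg (gaussL2 n) (sum_star_smul_hermiteMv_eq hn hY m
    ((innerSL ℂ f).toLinearMap ∘ₗ gaussL2 n))
  simp only [map_sum, map_smul, LinearMap.comp_apply, ContinuousLinearMap.coe_coe,
    innerSL_apply_apply, gaussL2_hermiteMv, gaussL2_phiMv, Complex.star_def, inner_conj_symm] at h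
  simp only [hermiteProjection, polarProjection, _root_.sum_apply,
    ContinuousLinearMap.smulRight_apply, innerSL_apply_apply]
  exact h

theorem hermiteKernel_eq_polarKernel (hn : 1 ≤ n) {Y : HarmonicBases n} (hY : Y.IsOrthonormal)
    (m : ℕ) (x y : Rn n) : hermiteKernel n m x y = polarKernel Y m x y := by
  have hphi : ∀ t : PhiIndex n, gaussFun n (phiMv Y t) = phiFun Y t.1.1 t.1.2 t.2 := fun t =>
    gaussFun_laguerreMv Y _ _ _
  have h := congrArg (fun p => gaussFun n p x) (sum_star_smul_hermiteMv_eq hn hY m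
    ((LinearMap.proj y : (Rn n → ℂ) →ₗ[ℂ] ℂ) ∘ₗ gaussFun n))
  simp only [map_sum, map_smul, LinearMap.comp_apply, LinearMap.proj_apply, Finset.sum_apply,
    Pi.smul_apply, smul_eq_mul, gaussFun_hermiteMv, hphi, hermiteFun_star] at h
  simp only [hermiteKernel, polarKernel, mul_comm (hermiteFun _ x), mul_comm (phiFun _ _ _ _ x)]
  exact h

theorem span_hermiteFun_eq_span_phiFun (hn : 1 ≤ n) {Y : HarmonicBases n} (hY : Y.IsOrthonormal)
    (m : ℕ) :
    Submodule.span ℂ {f : Rn n → ℂ | ∃ α : Fin n → ℕ, ∑ i, α i = m ∧ f = hermiteFun α} =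
      Submodule.span ℂ {f : Rn n → ℂ | ∃ (k : ℕ) (j : Fin (harmonicDim n (m - 2 * k))),
        k ≤ m / 2 ∧ f = phiFun Y k (m - 2 * k) j} := by
  have h := congrArg (Submodule.map (gaussFun n))
    ((span_hermiteMv_eq_eigenspace m).trans (span_phiMv_eq_eigenspace hn hY m).symm)
  rw [Submodule.map_span, Submodule.map_span, Set.image_image, ← Set.range_comp] at h
  simp only [gaussFun_hermiteMv] at h
  convert h using 2
  · ext f
    exact exists_congr fun α => and_congr_right fun _ => eq_comm
  · ext f
    constructor
    · rintro ⟨k, j, hk, rfl⟩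
      exact ⟨⟨⟨k, Nat.lt_succ_of_le hk⟩, j⟩, gaussFun_laguerreMv Y _ _ _⟩
    · rintro ⟨⟨k, j⟩, rfl⟩
      exact ⟨k, j, Nat.lt_succ_iff.mp k.2, gaussFun_laguerreMv Y _ _ _⟩

theorem exists_hilbertBasis_hermiteL2 :
    ∃ b : HilbertBasis (Fin n → ℕ) ℂ (L2 n), ⇑b = hermiteL2 :=
  exists_hilbertBasis_of_span_eq_top orthonormal_hermiteL2 gaussL2_hermiteMv
    (span_hermiteMv_eq_top linearIndependent_hermiteMv)

theorem exists_hilbertBasis_phiSystem (hn : 1 ≤ n) {Y : HarmonicBases n} (hY : Y.IsOrthonormal) :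
    ∃ b : HilbertBasis (PhiIndex n) ℂ (L2 n), ⇑b = phiSystem Y :=
  exists_hilbertBasis_of_span_eq_top (orthonormal_phiSystem hn hY) (gaussL2_phiMv Y)
    (span_phiMv_eq_top hn hY)

theorem hermiteOperator_eq_polarOperator (hn : 1 ≤ n) {Y : HarmonicBases n}
    (hY : Y.IsOrthonormal) : hermiteOperator n = polarOperator Y := by
  obtain ⟨b, hb⟩ := exists_hilbertBasis_hermiteL2 (n := n)
  obtain ⟨c, hc⟩ := exists_hilbertBasis_phiSystem hn hY
  rw [hermiteOperator, polarOperator, ← hb, ← hc]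
  refine diagonalOperator_eq_of_orthogonal b c _ _ fun α t h => ?_
  rw [hb, hc]
  refine inner_hermiteL2_phiSystem hn Y α t fun he => h ?_
  rw [he]
  push_cast
  ring

theorem isSelfAdjoint_hermiteOperator (n : ℕ) : IsSelfAdjoint (hermiteOperator n) := by
  obtain ⟨b, hb⟩ := exists_hilbertBasis_hermiteL2 (n := n)
  rw [hermiteOperator, ← hb]
  exact isSelfAdjoint_diagonalOperator b _

end Comparison
end PolarOscillator

end

theorem mainTheorem3 (n : ℕ) (hn : 1 ≤ n) (Y : PolarOscillator.HarmonicBases n)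
    (hY : Y.IsOrthonormal) :
    -- both systems are orthonormal bases of `L²(ℝⁿ)`
    (∃ b : HilbertBasis (Fin n → ℕ) ℂ (PolarOscillator.L2 n),
      ⇑b = PolarOscillator.hermiteL2) ∧
    (∃ b : HilbertBasis (PolarOscillator.PhiIndex n) ℂ (PolarOscillator.L2 n),
      ⇑b = PolarOscillator.phiSystem Y) ∧
    -- both operators are self-adjoint extensions of the harmonic oscillator
    IsSelfAdjoint (PolarOscillator.hermiteOperator n) ∧
    PolarOscillator.ExtendsHarmonicOscillator (PolarOscillator.hermiteOperator n) ∧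
    IsSelfAdjoint (PolarOscillator.polarOperator Y) ∧
    PolarOscillator.ExtendsHarmonicOscillator (PolarOscillator.polarOperator Y) ∧
    -- the two operators coincide
    PolarOscillator.hermiteOperator n = PolarOscillator.polarOperator Y ∧
    -- the spectral projections, their kernels and the projection spaces coincide
    ∀ m : ℕ,
      PolarOscillator.hermiteProjection n m = PolarOscillator.polarProjection Y m ∧
      (∀ x y : PolarOscillator.Rn n,
        PolarOscillator.hermiteKernel n m x y = PolarOscillator.polarKernel Y m x y) ∧
      Submodule.span ℂ {f : PolarOscillator.Rn n → ℂ |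
          ∃ α : Fin n → ℕ, ∑ i, α i = m ∧ f = PolarOscillator.hermiteFun α} =
        Submodule.span ℂ {f : PolarOscillator.Rn n → ℂ |
          ∃ (k : ℕ) (j : Fin (PolarOscillator.harmonicDim n (m - 2 * k))),
            k ≤ m / 2 ∧ f = PolarOscillator.phiFun Y k (m - 2 * k) j} := by
  have hH := PolarOscillator.exists_hilbertBasis_hermiteL2 (n := n)
  have heq := PolarOscillator.hermiteOperator_eq_polarOperator hn hY
  have hsa := PolarOscillator.isSelfAdjoint_hermiteOperator n
  have hext : PolarOscillator.ExtendsHarmonicOscillator (PolarOscillator.hermiteOperator n) := by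
    obtain ⟨b, hb⟩ := hH
    exact PolarOscillator.extendsHarmonicOscillator_hermiteOperator b hb
  exact ⟨hH, PolarOscillator.exists_hilbertBasis_phiSystem hn hY, hsa, hext, heq ▸ hsa,
    heq ▸ hext, heq, fun m => ⟨PolarOscillator.hermiteProjection_eq_polarProjection hn hY m,
      PolarOscillator.hermiteKernel_eq_polarKernel hn hY m,
      PolarOscillator.span_hermiteFun_eq_span_phiFun hn hY m⟩⟩
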